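/- Let $G$ be a finite group. Let $\hat G$ be a system of representatives, containing the trivial representation $\mathbf 1$, of the unitary equivalence classes of irreducible unitary representations of $G$. Each $\pi\in\hat G$ acts on a Hilbert space $H_\pi$ of dimension $d\pi$ with a fixed orthonormal basis, matrix units $e^\pi_{ij}\in B(H_\pi)$ and matrix coefficients $\pi(g)_{ij}$; $\bar\pi(g)=\overline{\pi(g)}$ (entrywise) is the conjugate representation. For representations $\sigma,\tau$ let $(\sigma,\tau)=\{T\in B(H_\sigma,H_\tau): T\sigma(g)=\tau(g)T \text{ for all } g\in G\}$. *Actions.* An action of $\hat G$ on a von Neumann algebra $M$ is a family $\alpha=\{\alpha_\pi\}_{\pi\in\hat G}$ of unital $*$-homomorphisms $\alpha_\pi:M\to M\otimes B(H_\pi)$ with $\alpha_{\mathbf 1}=\mathrm{id}_M$ and $(\alpha_\pi\otimes\mathrm{id}_\rho)(\alpha_\rho(x))\,T=T\,\alpha_\sigma(x)$ for all $x\in M$, $\pi,\rho,\sigma\in\hat G$, $T\in(\sigma,\pi\otimes\rho)$. It is free if for no $\pi\in\hat G$ with $\pi\neq\mathbf 1$ there is a nonzero $a\in M\otimes B(H_\pi)$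 with $\alpha_\pi(x)a=a(x\otimes 1_\pi)$ for all $x\in M$. It is outer if $M$ is a factor and $\alpha$ is free. *Canonical representation.* Let $\ell^2(\hat G)=\bigoplus_{\pi\in\hat G}B(H_\pi)$ with inner product $\langle v,w\rangle=\sum_\pi d\pi\,\mathrm{Tr}(w(\pi)^*v(\pi))$; it has the orthonormal basis $\{d\pi^{-1/2}e^\pi_{ij}\}$ and dimension $|G|$. For $\rho,\pi,\sigma\in\hat G$ fix an orthonormal basis $\{T^{\bar\sigma,e}_{\bar\rho,\pi}\}_e$ of $(\bar\sigma,\bar\rho\otimes\pi)$ for the inner product $\langle T,S\rangle 1=S^*T$, and let $T^{\bar\sigma,e}_{\bar\rho,\pi_i}$ be the matrix from $H_\sigma$ to $H_\rho$ with $(j,k)$ entry $(T^{\bar\sigma,e}_{\bar\rho,\pi})_{(j,i),k}$. Define $\lambda_{\pi_{ij}}\in B(\ell^2(\hat G))$ by $$(\lambda_{\pi_{ij}}v)(\rho)=\sum_{\sigma,e}T^{\bar\sigma,e}_{\bar\rho,\pi_i}\,v(\sigma)\,(T^{\bar\sigma,e}_{\bar\rho,\pi_j})^*,\qquad \lambda_\pi=\sum_{i,j}\lambda_{\pi_{ij}}\otimes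 e^\pi_{ij}.$$ *Model action.* Let $\mathcal R=\bigotimes_{n=1}^\infty K_n$ be the von Neumann algebra infinite tensor product, with respect to the normalized traces, of copies $K_n$ of $B(\ell^2(\hat G))\cong M_{|G|}(\mathbf C)$, that is, the von Neumann algebra generated by $\bigcup_n K_1\otimes\cdots\otimes K_n$ in the GNS representation of the product trace. Let $\lambda^n_\pi\in\mathcal R\otimes B(H_\pi)$ be the copy of $\lambda_\pi$ in $K_n\otimes B(H_\pi)$, and let $\tilde\lambda^n_\pi=\lambda^1_\pi\lambda^2_\pi\cdots\lambda^n_\pi$ and $m^n_\pi(x)=\tilde\lambda^n_\pi(x\otimes 1_\pi)\tilde\lambda^{n*}_\pi$ for $x\in\mathcal R$. **Theorem.** The limit $m_\pi(x)=\lim_{n\to\infty}m^n_\pi(x)$ exists in the strong operator topology for all $\pi\in\hat G$ and $x\in\mathcal R$, the family $m=\{m_\pi\}_{\pi\in\hat G}$ is an action of $\hat G$ on $\mathcal R$ (the model action), and $m$ is outer: $\mathcal R$ is a factor, and for $\pi\ne\mathbf 1$ no nonzero $a\in\mathcal R\otimes B(H_\pi)$ satisfies $m_\pi(x)a=a(x\otimes1_\pi)$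 for all $x\in\mathcal R$. -/

import Mathlib

open scoped Matrix Kronecker Topology

noncomputable section

set_option linter.unusedSectionVars false

namespace GroupDual

/-! ## Unitary representations of a group and the dual -/

/-- A finite dimensional unitary representation of `G`, written in a fixed orthonormal basis of its
representation space `H_π = ℂ^dim`, so that `B(H_π)` is `Matrix (Fin dim) (Fin dim) ℂ`. -/
structure UnitaryRep (G : Type*) [Group G] where
  dim : ℕ
  hom : G →* Matrix.unitaryGroup (Fin dim) ℂ

namespace UnitaryRep

variable {G : Type*} [Group G]

/-- The matrix `π(g)`. -/
def mat (π : UnitaryRep G) (g : G) : Matrix (Fin π.dim) (Fin π.dim) ℂ := (π.hom g).1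

/-- The matrix of the conjugate representation `π̄(g)` in the conjugate basis. -/
def conjMat (π : UnitaryRep G) (g : G) : Matrix (Fin π.dim) (Fin π.dim) ℂ := (π.mat g).map star

/-- The underlying linear representation. -/
def toRepresentation (π : UnitaryRep G) : Representation ℂ G (Fin π.dim → ℂ) :=
  (Matrix.toLinAlgEquiv' : Matrix (Fin π.dim) (Fin π.dim) ℂ ≃ₐ[ℂ] _).toRingHom.toMonoidHom.comp
    ((Matrix.unitaryGroup (Fin π.dim) ℂ).subtype.comp π.hom)

/-- The trivial one dimensional representation. -/
def trivial (G : Type*) [Group G] : UnitaryRep G := ⟨1, 1⟩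

/-- Unitary equivalence. -/
def Equivalent (σ π : UnitaryRep G) : Prop :=
  ∃ U : Matrix (Fin π.dim) (Fin σ.dim) ℂ,
    Uᴴ * U = 1 ∧ U * Uᴴ = 1 ∧ ∀ g, U * σ.mat g = π.mat g * U

end UnitaryRep

section Intertwiners

variable {G : Type*} {m n : Type*} [Fintype m] [Fintype n] [DecidableEq m] [DecidableEq n]

/-- The space `(σ, τ)` of intertwiners `T : H_σ → H_τ`, `T σ(g) = τ(g) T`. -/
def intertwiners (σ : G → Matrix n n ℂ) (τ : G → Matrix m m ℂ) : Submodule ℂ (Matrix m n ℂ) where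
  carrier := {T | ∀ g, T * σ g = τ g * T}
  add_mem' ha hb g := by rw [Matrix.add_mul, Matrix.mul_add, ha g, hb g]
  zero_mem' g := by simp
  smul_mem' c T hT g := by rw [Matrix.smul_mul, Matrix.mul_smul, hT g]

/-- An orthonormal basis of `(σ, τ)` (`σ` irreducible) for the inner product `⟨T, S⟩ 1 = S* T`. -/
structure IntertwinerBasis (σ : G → Matrix n n ℂ) (τ : G → Matrix m m ℂ) where
  mult : ℕ
  T : Fin mult → Matrix m n ℂ
  mem : ∀ e, T e ∈ intertwiners σ τ
  orthonormal : ∀ e f, (T e)ᴴ * T f = if e = f then 1 else 0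
  span : Submodule.span ℂ (Set.range T) = intertwiners σ τ

end Intertwiners

/-- The dual `Ĝ`: a (finite) system of representatives, containing the trivial representation,
of the unitary equivalence classes of irreducible unitary representations of `G`. -/
structure Dual (G : Type*) [Group G] where
  Idx : Type
  [fintype : Fintype Idx]
  [decEq : DecidableEq Idx]
  rep : Idx → UnitaryRep G
  irreducible : ∀ π, (rep π).toRepresentation.IsIrreducible
  inequivalent : ∀ π ρ, (rep π).Equivalent (rep ρ) → π = ρ
  complete : ∀ σ : UnitaryRep G, σ.toRepresentation.IsIrreducible → ∃ π, (rep π).Equivalent σ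
  one : Idx
  rep_one : rep one = UnitaryRep.trivial G

attribute [instance] Dual.fintype Dual.decEq

namespace Dual

variable {G : Type*} [Group G] (D : Dual G)

/-- The dimension `dπ`. -/
abbrev dim (π : D.Idx) : ℕ := (D.rep π).dim

/-- Matrices over `A` of size `dπ`; this is `A ⊗ B(H_π)`. -/
abbrev Mat (π : D.Idx) (A : Type*) : Type _ := Matrix (Fin (D.dim π)) (Fin (D.dim π)) A

/-- The matrix coefficients `(π, i, j)`; they index an orthonormal basis of `ℓ²(Ĝ)`. -/
abbrev Coeff : Type := Σ π : D.Idx, Fin (D.dim π) × Fin (D.dim π)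

instance : Nonempty D.Coeff := by
  have h : 0 < D.dim D.one := by simp [dim, D.rep_one, UnitaryRep.trivial]
  exact ⟨⟨D.one, ⟨0, h⟩, ⟨0, h⟩⟩⟩

end Dual

/-! ## Actions of the dual on a von Neumann algebra -/

section Actions

variable {G : Type*} [Group G]
variable {H : Type*} [NormedAddCommGroup H] [InnerProductSpace ℂ H] [CompleteSpace H]

/-- `a ⊗ 1` in `M ⊗ B(ℂ^n)`. -/
abbrev ampl {A n : Type*} [Zero A] [DecidableEq n] (x : A) : Matrix n n A :=
  Matrix.diagonal fun _ => x

/-- A scalar matrix `T` regarded as `1 ⊗ T`. -/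
abbrev scalarMat {A m n : Type*} [Ring A] [Algebra ℂ A] (T : Matrix m n ℂ) : Matrix m n A :=
  T.map (algebraMap ℂ A)

/-- `(φ ⊗ id)(X)` in `M ⊗ B(ℂ^p) ⊗ B(ℂ^q)` for `φ : M → M ⊗ B(ℂ^p)` and `X` in
`M ⊗ B(ℂ^q)`. -/
def tensorId {A p q : Type*} (φ : A → Matrix p p A) (X : Matrix q q A) :
    Matrix (p × q) (p × q) A :=
  fun a b => φ (X a.2 b.2) a.1 b.1

/-- An action of `Ĝ` on the von Neumann algebra `M`: unital `*`-homomorphisms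
`α_π : M → M ⊗ B(H_π)` with `α_1 = id` and `(α_π ⊗ id_ρ)(α_ρ(x)) T = T α_σ(x)` for all
`T ∈ (σ, π ⊗ ρ)`. -/
structure DualAction (D : Dual G) (M : VonNeumannAlgebra H) where
  map : ∀ π : D.Idx, M.toStarSubalgebra →⋆ₐ[ℂ] D.Mat π M.toStarSubalgebra
  map_one : ∀ x, map D.one x = ampl x
  map_tensor : ∀ (π ρ σ : D.Idx) (T : Matrix (Fin (D.dim π) × Fin (D.dim ρ)) (Fin (D.dim σ)) ℂ),
    T ∈ intertwiners (D.rep σ).mat (fun g => (D.rep π).mat g ⊗ₖ (D.rep ρ).mat g) →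
    ∀ x, tensorId (map π) (map ρ x) * scalarMat T = scalarMat T * map σ x

/-- The centre of `M` consists of the scalars. -/
def IsFactor (M : VonNeumannAlgebra H) : Prop :=
  ∀ x ∈ M, x ∈ M.commutant → ∃ c : ℂ, x = c • (1 : H →L[ℂ] H)

namespace DualAction

variable {D : Dual G} {M : VonNeumannAlgebra H} (α : DualAction D M)

/-- For no `π ≠ 1` is there a nonzero `a ∈ M ⊗ B(H_π)` with `α_π(x) a = a (x ⊗ 1)` for all
`x ∈ M`. -/
def IsFree : Prop :=
  ∀ π : D.Idx, π ≠ D.one →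
    ¬ ∃ a : D.Mat π M.toStarSubalgebra, a ≠ 0 ∧ ∀ x, α.map π x * a = a * ampl x

/-- An action is outer if it is a free action on a factor. -/
def IsOuter : Prop := IsFactor M ∧ α.IsFree

end DualAction

/-- The von Neumann algebra `s''` generated by a set `s` of operators (and their adjoints). -/
def generated (s : Set (H →L[ℂ] H)) : VonNeumannAlgebra H where
  toStarSubalgebra :=
    StarSubalgebra.centralizer ℂ (StarSubalgebra.centralizer ℂ s : Set (H →L[ℂ] H))
  centralizer_centralizer' := by
    change Set.centralizer (Set.centralizer (Set.centralizer _)) = Set.centralizer _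
    exact Set.centralizer_centralizer_centralizer _

theorem subset_generated (s : Set (H →L[ℂ] H)) {x : H →L[ℂ] H} (hx : x ∈ s) :
    x ∈ (generated s).toStarSubalgebra := by
  change x ∈ StarSubalgebra.centralizer ℂ _
  rw [StarSubalgebra.mem_centralizer_iff]
  intro g hg
  have hg2 : star g ∈ StarSubalgebra.centralizer ℂ s := star_mem hg
  rw [SetLike.mem_coe, StarSubalgebra.mem_centralizer_iff] at hg
  rw [StarSubalgebra.mem_centralizer_iff] at hg2
  exact ⟨(hg x hx).1.symm, (hg2 x hx).1.symm⟩

end Actions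

/-! ## The infinite tensor product of matrix algebras with respect to the trace -/

section InfiniteTensor

variable (I : Type) [Fintype I] [DecidableEq I]

/-- `M_I(ℂ)^{⊗ n}`. -/
abbrev Level (n : ℕ) : Type := Matrix (Fin n → I) (Fin n → I) ℂ

variable {I}

/-- A word of length `n + 1` as its initial part and its last letter. -/
def splitLast (n : ℕ) : (Fin (n + 1) → I) ≃ (Fin n → I) × I :=
  (Fin.snocEquiv fun _ => I).symm.trans (Equiv.prodComm _ _)

/-- `a ⊗ b` in `M_I(ℂ)^{⊗ (n+1)}` for `a ∈ M_I(ℂ)^{⊗ n}` and `b ∈ M_I(ℂ)`. -/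
def tensorLast {n : ℕ} (a : Level I n) (b : Matrix I I ℂ) : Level I (n + 1) :=
  (a ⊗ₖ b).submatrix (splitLast n) (splitLast n)

theorem tensorLast_mul {n : ℕ} (a a' : Level I n) (b b' : Matrix I I ℂ) :
    tensorLast (a * a') (b * b') = tensorLast a b * tensorLast a' b' := by
  simp only [tensorLast, Matrix.mul_kronecker_mul, Matrix.submatrix_mul_equiv]

theorem tensorLast_add {n : ℕ} (a a' : Level I n) (b : Matrix I I ℂ) :
    tensorLast (a + a') b = tensorLast a b + tensorLast a' b := by
  simp only [tensorLast, Matrix.add_kronecker, Matrix.submatrix_add, Pi.add_apply]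

theorem tensorLast_smul {n : ℕ} (c : ℂ) (a : Level I n) (b : Matrix I I ℂ) :
    tensorLast (c • a) b = c • tensorLast a b := by
  simp only [tensorLast, Matrix.smul_kronecker, Matrix.submatrix_smul, Pi.smul_apply]

theorem tensorLast_one {n : ℕ} : tensorLast (1 : Level I n) 1 = 1 := by
  simp [tensorLast]

theorem tensorLast_zero {n : ℕ} (b : Matrix I I ℂ) : tensorLast (0 : Level I n) b = 0 := by
  simp [tensorLast]

theorem tensorLast_star {n : ℕ} (a : Level I n) :
    tensorLast (star a) 1 = star (tensorLast a 1) := by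
  simp only [tensorLast, Matrix.star_eq_conjTranspose, Matrix.conjTranspose_submatrix,
    Matrix.conjTranspose_kronecker, Matrix.conjTranspose_one]

/-- The normalized trace on `M_I(ℂ)^{⊗ n}`. -/
def normTrace {n : ℕ} (a : Level I n) : ℂ := a.trace / (Fintype.card I : ℂ) ^ n

theorem normTrace_tensorLast [Nonempty I] {n : ℕ} (a : Level I n) :
    normTrace (tensorLast a 1) = normTrace a := by
  have hI : (Fintype.card I : ℂ) ≠ 0 := by simp
  have h : (tensorLast a (1 : Matrix I I ℂ)).trace = a.trace * Fintype.card I := by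
    rw [tensorLast, ← Matrix.trace_one, ← Matrix.trace_kronecker]
    exact Fintype.sum_equiv (splitLast n) _ _ fun _ => rfl
  rw [normTrace, normTrace, h, pow_succ]
  field_simp

variable (I)

/-- The sequences `(a_n)`, `a_n ∈ M_I(ℂ)^{⊗ n}`, with `a_{n+1} = a_n ⊗ 1` for all large `n`.
Up to eventually vanishing sequences this is the algebraic infinite tensor product
`⋃_n M_I(ℂ)^{⊗ n}`. -/
def coherent : StarSubalgebra ℂ (∀ n, Level I n) where
  carrier := {a | ∃ N, ∀ n, N ≤ n → a (n + 1) = tensorLast (a n) 1}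
  mul_mem' := by
    rintro a b ⟨N, hN⟩ ⟨K, hK⟩
    refine ⟨max N K, fun n hn => ?_⟩
    rw [Pi.mul_apply, Pi.mul_apply, hN n (le_of_max_le_left hn), hK n (le_of_max_le_right hn),
      ← tensorLast_mul, mul_one]
  add_mem' := by
    rintro a b ⟨N, hN⟩ ⟨K, hK⟩
    refine ⟨max N K, fun n hn => ?_⟩
    rw [Pi.add_apply, Pi.add_apply, hN n (le_of_max_le_left hn), hK n (le_of_max_le_right hn),
      ← tensorLast_add]
  algebraMap_mem' c := by
    refine ⟨0, fun n _ => ?_⟩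
    simp only [Algebra.algebraMap_eq_smul_one, Pi.smul_apply, Pi.one_apply, tensorLast_smul,
      tensorLast_one]
  star_mem' := by
    rintro a ⟨N, hN⟩
    refine ⟨N, fun n hn => ?_⟩
    rw [Pi.star_apply, Pi.star_apply, hN n hn, tensorLast_star]

/-- The algebraic infinite tensor product `⋃_n M_I(ℂ)^{⊗ n}` (represented by sequences). -/
def AlgTensor : Type := coherent I

instance : Ring (AlgTensor I) := inferInstanceAs (Ring (coherent I))
instance : StarRing (AlgTensor I) := inferInstanceAs (StarRing (coherent I))
instance : Algebra ℂ (AlgTensor I) := inferInstanceAs (Algebra ℂ (coherent I))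
instance : StarModule ℂ (AlgTensor I) := inferInstanceAs (StarModule ℂ (coherent I))

variable {I}

/-- The product trace `τ((a_n)) = lim tr_n(a_n)`. -/
def tau (a : AlgTensor I) : ℂ := Filter.atTop.limUnder fun n => normTrace (a.1 n)

theorem tau_eventually [Nonempty I] (a : AlgTensor I) :
    ∃ N, ∀ n, N ≤ n → normTrace (a.1 n) = tau a := by
  obtain ⟨N, hN⟩ := a.2
  have h : ∀ n, N ≤ n → normTrace (a.1 n) = normTrace (a.1 N) := by
    intro n hn
    induction n, hn using Nat.le_induction with
    | base => rfl
    | succ n hn ih => rw [hN n hn, normTrace_tensorLast, ih]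
  have ht : Filter.Tendsto (fun n => normTrace (a.1 n)) Filter.atTop (𝓝 (normTrace (a.1 N))) :=
    tendsto_const_nhds.congr' (Filter.eventually_atTop.2 ⟨N, fun n hn => (h n hn).symm⟩)
  exact ⟨N, fun n hn => (h n hn).trans ht.limUnder_eq.symm⟩

theorem tau_add [Nonempty I] (a b : AlgTensor I) : tau (a + b) = tau a + tau b := by
  obtain ⟨N, hN⟩ := tau_eventually a
  obtain ⟨K, hK⟩ := tau_eventually b
  obtain ⟨L, hL⟩ := tau_eventually (a + b)
  rw [← hN (N + K + L) (by omega), ← hK (N + K + L) (by omega), ← hL (N + K + L) (by omega)]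
  change normTrace (a.1 _ + b.1 _) = _
  simp only [normTrace, Matrix.trace_add, add_div]

theorem tau_smul [Nonempty I] (c : ℂ) (a : AlgTensor I) : tau (c • a) = c * tau a := by
  obtain ⟨N, hN⟩ := tau_eventually a
  obtain ⟨L, hL⟩ := tau_eventually (c • a)
  rw [← hN (N + L) (by omega), ← hL (N + L) (by omega)]
  change normTrace (c • a.1 _) = _
  simp only [normTrace, Matrix.trace_smul, smul_eq_mul, mul_div_assoc]

theorem tau_star [Nonempty I] (a : AlgTensor I) : tau (star a) = star (tau a) := by
  obtain ⟨N, hN⟩ := tau_eventually a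
  obtain ⟨L, hL⟩ := tau_eventually (star a)
  rw [← hN (N + L) (by omega), ← hL (N + L) (by omega)]
  change normTrace (star (a.1 _)) = _
  simp [normTrace, Matrix.star_eq_conjTranspose, Matrix.trace_conjTranspose]

section Positive

open scoped ComplexOrder

theorem normTrace_star_mul_self_nonneg {n : ℕ} (a : Level I n) :
    0 ≤ (normTrace (star a * a)).re := by
  have h := (Matrix.posSemidef_conjTranspose_mul_self a).trace_nonneg
  have e : normTrace (star a * a) = (aᴴ * a).trace * (((Fintype.card I : ℝ) ^ n)⁻¹ : ℝ) := by
    rw [normTrace, div_eq_mul_inv]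
    push_cast
    rfl
  rw [e, Complex.re_mul_ofReal]
  exact mul_nonneg (Complex.le_def.1 h).1 (by positivity)

end Positive

theorem tau_star_mul_self_nonneg [Nonempty I] (a : AlgTensor I) : 0 ≤ (tau (star a * a)).re := by
  obtain ⟨N, hN⟩ := tau_eventually (star a * a)
  rw [← hN N le_rfl]
  exact normTrace_star_mul_self_nonneg (a.1 N)

/-- The GNS inner product `⟨a, b⟩ = τ(a* b)` (conjugate linear in the first variable). -/
@[reducible]
def gnsCore [Nonempty I] : PreInnerProductSpace.Core ℂ (AlgTensor I) where
  inner a b := tau (star a * b)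
  conj_inner_symm a b := by
    change star (tau (star b * a)) = tau (star a * b)
    rw [← tau_star, star_mul, star_star]
  re_inner_nonneg a := tau_star_mul_self_nonneg a
  add_left a b c := by rw [star_add, add_mul, tau_add]
  smul_left a b r := by rw [star_smul, smul_mul_assoc, tau_smul]; rfl

instance [Nonempty I] : SeminormedAddCommGroup (AlgTensor I) :=
  @InnerProductSpace.Core.toSeminormedAddCommGroup ℂ (AlgTensor I) _ _ _ gnsCore

instance [Nonempty I] : InnerProductSpace ℂ (AlgTensor I) := InnerProductSpace.ofCore gnsCore

theorem inner_eq_tau [Nonempty I] (a b : AlgTensor I) : inner ℂ a b = tau (star a * b) := rfl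

section Bound

open scoped Matrix.Norms.L2Operator MatrixOrder

theorem exists_level_bound {n : ℕ} (a : Level I n) :
    ∃ (C : ℝ) (c : Level I n), (C : ℂ) • (1 : Level I n) - star a * a = star c * c := by
  have h := sub_nonneg.2 (CStarAlgebra.star_mul_le_algebraMap_norm_sq (a := a))
  obtain ⟨c, hc⟩ := CStarAlgebra.nonneg_iff_eq_star_mul_self.1 h
  refine ⟨‖a‖ ^ 2, c, ?_⟩
  rw [← hc, Algebra.algebraMap_eq_smul_one]
  rfl

end Bound

theorem exists_bound [Nonempty I] (a : AlgTensor I) :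
    ∃ C : ℝ, ∀ b : AlgTensor I, ‖a * b‖ ≤ C * ‖b‖ := by
  obtain ⟨N, hN⟩ := a.2
  obtain ⟨C, c, hc⟩ := exists_level_bound (a.1 N)
  have key : ∀ n, N ≤ n →
      ∃ c : Level I n, (C : ℂ) • (1 : Level I n) - star (a.1 n) * a.1 n = star c * c := by
    intro n hn
    induction n, hn using Nat.le_induction with
    | base => exact ⟨c, hc⟩
    | succ n hn ih =>
      obtain ⟨d, hd⟩ := ih
      refine ⟨tensorLast d 1, ?_⟩
      rw [hN n hn, ← tensorLast_star, ← tensorLast_star, ← tensorLast_mul, ← tensorLast_mul,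
        mul_one, ← hd, sub_eq_add_neg, sub_eq_add_neg, tensorLast_add, tensorLast_smul,
        tensorLast_one, ← neg_one_smul ℂ (star (a.1 n) * a.1 n), tensorLast_smul, neg_one_smul]
  have sq : ∀ b : AlgTensor I, ‖a * b‖ ^ 2 ≤ C * ‖b‖ ^ 2 := by
    intro b
    rw [@norm_sq_eq_re_inner ℂ, @norm_sq_eq_re_inner ℂ, inner_eq_tau, inner_eq_tau]
    obtain ⟨K, hK⟩ := tau_eventually (star (a * b) * (a * b))
    obtain ⟨L, hL⟩ := tau_eventually (star b * b)
    rw [← hK (N + K + L) (by omega), ← hL (N + K + L) (by omega)]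
    obtain ⟨d, hd⟩ := key (N + K + L) (by omega)
    have h := normTrace_star_mul_self_nonneg (d * b.1 (N + K + L))
    change (normTrace (star (a.1 _ * b.1 _) * (a.1 _ * b.1 _))).re ≤
      C * (normTrace (star (b.1 _) * b.1 _)).re
    have e : star (d * b.1 (N + K + L)) * (d * b.1 (N + K + L)) =
        (C : ℂ) • (star (b.1 (N + K + L)) * b.1 (N + K + L)) -
          star (a.1 (N + K + L) * b.1 (N + K + L)) * (a.1 (N + K + L) * b.1 (N + K + L)) := by
      rw [star_mul, mul_assoc, ← mul_assoc (star d), ← hd, sub_mul, mul_sub, smul_mul_assoc,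
        one_mul, mul_smul_comm, star_mul]
      simp only [mul_assoc]
    rw [e] at h
    simp only [normTrace, Matrix.trace_sub, Matrix.trace_smul, sub_div, smul_eq_mul,
      mul_div_assoc, Complex.sub_re, Complex.re_ofReal_mul] at h ⊢
    linarith
  refine ⟨√(max C 0), fun b => ?_⟩
  refine abs_le_of_sq_le_sq' ?_ (by positivity) |>.2
  rw [mul_pow, Real.sq_sqrt (le_max_right _ _)]
  exact (sq b).trans (mul_le_mul_of_nonneg_right (le_max_left _ _) (by positivity))

variable (I) in
/-- The Hilbert space completion of the algebraic tensor product with respect to `τ(a* b)`. -/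
abbrev GNSSpace [Nonempty I] : Type := UniformSpace.Completion (AlgTensor I)

/-- The operator of left multiplication by `a` on the GNS space. -/
def leftMul [Nonempty I] (a : AlgTensor I) : GNSSpace I →L[ℂ] GNSSpace I :=
  ((LinearMap.mulLeft ℂ a).mkContinuousOfExistsBound (exists_bound a)).completion

variable (I) in
/-- `R = ⨂_{n ≥ 1} M_I(ℂ)`: the von Neumann algebra generated by the algebraic infinite tensor
product in the GNS representation of the product trace. -/
def tensorFactor [Nonempty I] : VonNeumannAlgebra (GNSSpace I) :=
  generated (Set.range leftMul)

/-- The elementary tensor `1 ⊗ ⋯ ⊗ 1 ⊗ b ⊗ 1 ⊗ ⋯` with `b` in the factor number `k`, `k = 0, 1, …`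
(the values at the levels up to `k` are irrelevant). -/
def site (k : ℕ) (b : Matrix I I ℂ) : ∀ n, Level I n
  | 0 => 0
  | n + 1 => if n = k then tensorLast 1 b else tensorLast (site k b n) 1

/-- The embedding of `K_k = M_I(ℂ)` in the algebraic tensor product. -/
def siteAlg (k : ℕ) (b : Matrix I I ℂ) : AlgTensor I :=
  ⟨site k b, k + 1, fun n hn => by rw [site, if_neg (by omega)]⟩

/-- The embedding of the factor number `k` in `R = ⨂_n K_n`. -/
def siteEmb [Nonempty I] (k : ℕ) (b : Matrix I I ℂ) : (tensorFactor I).toStarSubalgebra :=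
  ⟨leftMul (siteAlg k b), subset_generated _ ⟨_, rfl⟩⟩

end InfiniteTensor

/-! ## The canonical representation on `ℓ²(Ĝ)` and the model action -/

section Model

variable {G : Type*} [Group G] (D : Dual G)

/-- `ℓ²(Ĝ) = ⊕_π B(H_π)`. -/
abbrev EllTwo : Type := ∀ π : D.Idx, D.Mat π ℂ

variable {D}

/-- The inner product `⟨v, w⟩ = ∑_π dπ Tr(w(π)* v(π))` of `ℓ²(Ĝ)`. -/
def ellInner (v w : EllTwo D) : ℂ := ∑ π, (D.dim π : ℂ) * ((w π)ᴴ * v π).trace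

/-- The orthonormal basis `dπ^{-1/2} e^π_{ij}` of `ℓ²(Ĝ)`. -/
def ellBasis (a : D.Coeff) : EllTwo D :=
  Pi.single a.1 ((((√(D.dim a.1 : ℝ))⁻¹ : ℝ) : ℂ) • Matrix.single a.2.1 a.2.2 (1 : ℂ))

variable (D) in
/-- A choice of orthonormal bases `T_{ρ̄,π}^{σ̄,e}` of the spaces `(σ̄, ρ̄ ⊗ π)`. -/
abbrev BasisChoice : Type :=
  ∀ ρ π σ : D.Idx, IntertwinerBasis (D.rep σ).conjMat
    (fun g => (D.rep ρ).conjMat g ⊗ₖ (D.rep π).mat g)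

/-- `T_{ρ̄,π_i}^{σ̄,e}` as an operator from `H_σ` to `H_ρ`. -/
def slice (T : BasisChoice D) (ρ π σ : D.Idx) (e : Fin (T ρ π σ).mult) (i : Fin (D.dim π)) :
    Matrix (Fin (D.dim ρ)) (Fin (D.dim σ)) ℂ :=
  fun j k => (T ρ π σ).T e (j, i) k

/-- The operator `λ_{π_{ij}}` on `ℓ²(Ĝ)`:
`(λ_{π_{ij}} v)(ρ) = ∑_{σ,e} T_{ρ̄,π_i}^{σ̄,e} v(σ) (T_{ρ̄,π_j}^{σ̄,e})*`. -/
def lambdaOp (T : BasisChoice D) (π : D.Idx) (i j : Fin (D.dim π)) (v : EllTwo D) : EllTwo D :=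
  fun ρ => ∑ σ, ∑ e, slice T ρ π σ e i * v σ * (slice T ρ π σ e j)ᴴ

/-- The matrix of `λ_{π_{ij}}` in the orthonormal basis `dπ^{-1/2} e^π_{ij}`, which identifies
`B(ℓ²(Ĝ))` with the matrix algebra `M_{|G|}(ℂ)`. -/
def lambdaMat (T : BasisChoice D) (π : D.Idx) (i j : Fin (D.dim π)) : Matrix D.Coeff D.Coeff ℂ :=
  fun a b => ellInner (lambdaOp T π i j (ellBasis b)) (ellBasis a)

variable (D) in
/-- The Hilbert space on which `R` acts. -/
abbrev ModelSpace : Type := GNSSpace D.Coeff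

variable (D) in
/-- `R = ⨂_n K_n`, where each `K_n` is a copy of `B(ℓ²(Ĝ)) = M_{|G|}(ℂ)`. -/
abbrev modelAlgebra : VonNeumannAlgebra (ModelSpace D) := tensorFactor D.Coeff

/-- The representation `λ_π^k` of `Ĝ` in the tensor factor number `k` of `R`. -/
def lambdaSite (T : BasisChoice D) (k : ℕ) (π : D.Idx) :
    D.Mat π (modelAlgebra D).toStarSubalgebra :=
  fun i j => siteEmb k (lambdaMat T π i j)

/-- The product `λ̃_π^n` of the `λ_π^k` over the first `n` tensor factors. -/
def lambdaTilde (T : BasisChoice D) (π : D.Idx) :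
    ℕ → D.Mat π (modelAlgebra D).toStarSubalgebra
  | 0 => 1
  | n + 1 => lambdaTilde T π n * lambdaSite T n π

/-- `m_π^n(x) = Ad λ̃_π^n (x ⊗ 1)`. -/
def modelApprox (T : BasisChoice D) (n : ℕ) (π : D.Idx) (x : (modelAlgebra D).toStarSubalgebra) :
    D.Mat π (modelAlgebra D).toStarSubalgebra :=
  lambdaTilde T π n * ampl x * (lambdaTilde T π n)ᴴ

/-- `m` is the model action: `m_π(x) = lim m_π^n(x)` in the strong operator topology, for all
`π` and all `x ∈ R`. -/
def IsModelAction (T : BasisChoice D) (m : DualAction D (modelAlgebra D)) : Prop :=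
  ∀ (π : D.Idx) (x : (modelAlgebra D).toStarSubalgebra) (i j : Fin (D.dim π)) (ξ : ModelSpace D),
    Filter.Tendsto (fun n => (modelApprox T n π x i j : ModelSpace D →L[ℂ] ModelSpace D) ξ)
      Filter.atTop (𝓝 ((m.map π x i j : ModelSpace D →L[ℂ] ModelSpace D) ξ))

end Model

end GroupDual

end

/-!
The algebra `C(G)` is the "group algebra" of `Ĝ`: a unitary representation of `Ĝ` in a `*`-algebra
`A` is the family `(φ(π(·)_{ij}))` for a `*`-homomorphism `φ : C(G) → A`. The proof makes this
explicit for the canonical representation. Since the isometries `T_{ρ̄,π}^{σ̄,e}` decompose `ρ̄ ⊗ π`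
(`sum_basis_mul_conjTranspose`), the vector `ρ ↦ ρ̄(g)` of `ℓ²(Ĝ)` is an eigenvector of `λ_{π_{ij}}`
with eigenvalue `π(g)_{ij}` (`lambdaOp_conjMat`). By Schur orthogonality and completeness of the
matrix coefficients these vectors, normalized, are an orthonormal basis, so the Fourier transform
turns `λ_{π_{ij}}` into multiplication by `π(·)_{ij}` (`lambdaMat_eq_multHom`). All relations of a
representation of `Ĝ` follow for `λ`, and for the products `λ̃ⁿ` of commuting copies of it
(`isDualRep_lambdaTilde`); moreover `Tr λ_{π_{ij}} = ∑_g π(g)_{ij} = 0` for `π ≠ 1`.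

*The limit.* On `K_1 ⊗ ⋯ ⊗ K_n` the sequence `m_π^k` is constant from `k = n` on. Let `l_a` and `r_a`
be left and right multiplication by `a` on the GNS space, and write `b` also for the vector of an
element `b` of the algebraic tensor product. Since `x` commutes with right multiplications,
`λ̃_{ik} x λ̃_{jk}^* b = l_u r_b r_v (x 1)` with `u = λ̃_{ik}` and `v = λ̃_{jk}^*`, and `l_u`, `r_v` are
contractions. Hence `‖m_π^n(x)_{ij} b‖ ≤ dπ ‖r_b‖ ‖x 1‖` uniformly in `n`
(`norm_modelApprox_coe_le`), and approximating the vector `x 1` by vectors of finite levels shows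
that the bounded sequence `m_π^n(x)` converges strongly (`exists_strongLim_modelApprox`). The same
estimate gives `m_π^n(y_n) → m_π(y)` for bounded `y_n → y`, so that the axioms of an action pass
from the inner actions `m^n` to the limit.

*Outerness.* Averaging over matrix units shows that a vector `ξ` commuting with level `n` satisfies
`⟨y, ξ⟩ = ⟨τ(y) 1, ξ⟩` for `y` of level `n` (`inner_coe_eq_of_commute`). For central `x` this applies
to `x 1` at every level and gives `x = ⟨1, x 1⟩`. If `π ≠ 1` and `m_π(x) a = a (x ⊗ 1)` for all `x`,
it applies to the entries of `b = λ̃^{n+1 *} a` at level `n + 1`; as `a = λ̃^{n+1} b`, the inner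
product of `a_{ij}` with `c` of level `n` is a combination of the numbers `τ(λ̃^{n+1 *}_{ik} c)`,
which vanish because the last tensor factor of `λ̃^{n+1}_{ik}` has trace zero. So `a = 0`.
-/

noncomputable section

set_option linter.unusedSectionVars false

namespace GroupDual

/-! ### Unitary matrix representations and complete reducibility -/

section Reps

variable {G : Type*} [Group G] {m : Type*} [Fintype m] [DecidableEq m]

/-- A unitary representation of `G` on `ℂ^m`, as a family of matrices; unlike `UnitaryRep` it
allows an arbitrary finite index type. -/
structure IsUnitaryMatRep (τ : G → Matrix m m ℂ) : Prop where
  one : τ 1 = 1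
  mul : ∀ g h, τ (g * h) = τ g * τ h
  conjTranspose_mul_self : ∀ g, (τ g)ᴴ * τ g = 1

namespace IsUnitaryMatRep

variable {τ : G → Matrix m m ℂ}

theorem conjTranspose_eq_inv (h : IsUnitaryMatRep τ) (g : G) : (τ g)ᴴ = τ g⁻¹ := by
  have h1 : τ g * τ g⁻¹ = 1 := by rw [← h.mul, mul_inv_cancel, h.one]
  rw [← mul_one (τ g)ᴴ, ← h1, ← mul_assoc, h.conjTranspose_mul_self, one_mul]

theorem mul_conjTranspose_self (h : IsUnitaryMatRep τ) (g : G) : τ g * (τ g)ᴴ = 1 := by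
  rw [h.conjTranspose_eq_inv, ← h.mul, mul_inv_cancel, h.one]

theorem map_star (h : IsUnitaryMatRep τ) : IsUnitaryMatRep fun g => (τ g).map star where
  one := by
    rw [h.one]
    exact Matrix.map_one _ (star_zero _) (star_one _)
  mul a b := by
    rw [h.mul]
    exact Matrix.map_mul (f := starRingEnd ℂ)
  conjTranspose_mul_self g := by
    have := congrArg (fun A : Matrix m m ℂ => A.map (starRingEnd ℂ)) (h.conjTranspose_mul_self g)
    simp only [Matrix.map_mul] at this
    rw [Matrix.map_one _ (map_zero _) (map_one _)] at this
    rw [← this]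
    rfl

theorem kronecker {n : Type*} [Fintype n] [DecidableEq n] {σ : G → Matrix n n ℂ}
    (h : IsUnitaryMatRep τ) (h' : IsUnitaryMatRep σ) :
    IsUnitaryMatRep fun g => τ g ⊗ₖ σ g where
  one := by rw [h.one, h'.one, Matrix.one_kronecker_one]
  mul a b := by rw [h.mul, h'.mul, Matrix.mul_kronecker_mul]
  conjTranspose_mul_self g := by
    rw [Matrix.conjTranspose_kronecker, ← Matrix.mul_kronecker_mul, h.conjTranspose_mul_self,
      h'.conjTranspose_mul_self, Matrix.one_kronecker_one]

/-- The adjoint of an intertwiner of unitary representations is an intertwiner. -/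
theorem conjTranspose_mem_intertwiners {n : Type*} [Fintype n] [DecidableEq n]
    {σ : G → Matrix n n ℂ} (h : IsUnitaryMatRep τ) (h' : IsUnitaryMatRep σ) {S : Matrix m n ℂ}
    (hS : S ∈ intertwiners σ τ) : Sᴴ ∈ intertwiners τ σ := by
  intro g
  have := congrArg Matrix.conjTranspose (hS g⁻¹)
  simpa only [Matrix.conjTranspose_mul, h.conjTranspose_eq_inv, h'.conjTranspose_eq_inv,
    inv_inv] using this.symm

end IsUnitaryMatRep

namespace UnitaryRep

theorem isUnitaryMatRep (π : UnitaryRep G) : IsUnitaryMatRep π.mat where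
  one := by simp [mat]
  mul a b := by simp [mat]
  conjTranspose_mul_self g := Matrix.mem_unitaryGroup_iff'.1 (π.hom g).2

theorem isUnitaryMatRep_conjMat (π : UnitaryRep G) : IsUnitaryMatRep π.conjMat :=
  π.isUnitaryMatRep.map_star

theorem eq_bot_or_eq_top (π : UnitaryRep G) (h : π.toRepresentation.IsIrreducible)
    (W : Submodule ℂ (Fin π.dim → ℂ)) (hW : ∀ g, ∀ v ∈ W, π.mat g *ᵥ v ∈ W) :
    W = ⊥ ∨ W = ⊤ := by
  rcases h.eq_bot_or_eq_top (⟨W, fun g v hv => hW g v hv⟩ : Subrepresentation π.toRepresentation)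
    with h | h
  · exact Or.inl (congrArg Subrepresentation.toSubmodule h)
  · exact Or.inr (congrArg Subrepresentation.toSubmodule h)

theorem dim_pos (π : UnitaryRep G) (h : π.toRepresentation.IsIrreducible) : 0 < π.dim := by
  by_contra h0
  have : IsEmpty (Fin π.dim) := ⟨fun i => h0 i.pos⟩
  have : Subsingleton (Submodule ℂ (Fin π.dim → ℂ)) := inferInstance
  exact bot_ne_top (α := Subrepresentation π.toRepresentation)
    (Subrepresentation.toSubmodule_injective (Subsingleton.elim _ _))

end UnitaryRep

/-- The columns of `V` are an orthonormal basis of the subspace `W`. -/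
theorem exists_isometry_onto (W : Submodule ℂ (m → ℂ)) :
    ∃ (d : ℕ) (V : Matrix m (Fin d) ℂ), Vᴴ * V = 1 ∧ (∀ u, V *ᵥ u ∈ W) ∧
      ∀ w ∈ W, V *ᵥ (Vᴴ *ᵥ w) = w := by
  let E : Submodule ℂ (EuclideanSpace ℂ m) :=
    W.comap (WithLp.linearEquiv 2 ℂ (m → ℂ)).toLinearMap
  let b := stdOrthonormalBasis ℂ E
  let V : Matrix m (Fin (Module.finrank ℂ E)) ℂ := fun j k => (b k : EuclideanSpace ℂ m) j
  have hVu : ∀ u, V *ᵥ u = (WithLp.ofLp (∑ k, u k • (b k : EuclideanSpace ℂ m))) := by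
    intro u
    ext j
    rw [WithLp.ofLp_sum, Finset.sum_apply]
    change ∑ k, V j k * u k = ∑ k, u k * V j k
    exact Finset.sum_congr rfl fun k _ => mul_comm (_ : ℂ) _
  refine ⟨_, V, ?_, fun u => ?_, fun w hw => ?_⟩
  · ext k l
    have := orthonormal_iff_ite.1 b.orthonormal k l
    rw [Submodule.coe_inner, PiLp.inner_apply] at this
    rw [Matrix.one_apply, ← this, Matrix.mul_apply]
    exact Finset.sum_congr rfl fun j _ => mul_comm (_ : ℂ) _
  · rw [hVu]
    have : ∑ k, u k • (b k : EuclideanSpace ℂ m) ∈ E :=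
      Submodule.sum_mem _ fun k _ => Submodule.smul_mem _ _ (b k).2
    exact this
  · have h := b.sum_repr' (⟨WithLp.toLp 2 w, hw⟩ : E)
    have h2 := congrArg (fun e : E => WithLp.ofLp (e : EuclideanSpace ℂ m)) h
    simp only [Submodule.coe_sum, Submodule.coe_smul, Submodule.coe_inner,
      PiLp.inner_apply] at h2
    rw [hVu]
    refine Eq.trans (congrArg WithLp.ofLp ?_) h2
    refine Finset.sum_congr rfl fun k _ => ?_
    congr 1
    exact Finset.sum_congr rfl fun j _ => mul_comm (_ : ℂ) _

/-- Every nonzero invariant subspace contains the range of an isometric intertwiner from an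
irreducible representation: an orthonormal basis of a minimal invariant subspace. -/
theorem IsUnitaryMatRep.exists_irreducible {τ : G → Matrix m m ℂ} (hτ : IsUnitaryMatRep τ)
    (W : Submodule ℂ (m → ℂ)) (hW : ∀ g, ∀ v ∈ W, τ g *ᵥ v ∈ W) (h0 : W ≠ ⊥) :
    ∃ (σ : UnitaryRep G) (V : Matrix m (Fin σ.dim) ℂ), σ.toRepresentation.IsIrreducible ∧
      Vᴴ * V = 1 ∧ V ∈ intertwiners σ.mat τ ∧ ∀ u, V *ᵥ u ∈ W := by
  obtain ⟨W', ⟨h0', hinv, hle⟩, hmin⟩ := wellFounded_lt.has_min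
    {W' : Submodule ℂ (m → ℂ) | W' ≠ ⊥ ∧ (∀ g, ∀ v ∈ W', τ g *ᵥ v ∈ W') ∧ W' ≤ W}
    ⟨W, h0, hW, le_rfl⟩
  obtain ⟨d, V, hVV, hVmem, hproj⟩ := exists_isometry_onto W'
  have hprojM : ∀ g, V * (Vᴴ * (τ g * V)) = τ g * V := by
    intro g
    refine Matrix.ext_of_mulVec_single fun k => ?_
    simp only [← Matrix.mulVec_mulVec]
    exact hproj _ (hinv g _ (hVmem _))
  let s : G → Matrix (Fin d) (Fin d) ℂ :=
    fun g => Vᴴ * (τ g * V)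
  have hs1 : s 1 = 1 := by simp [s, hτ.one, hVV]
  have hsmul : ∀ g h, s (g * h) = s g * s h := by
    intro g h
    simp only [s, hτ.mul]
    rw [Matrix.mul_assoc, Matrix.mul_assoc, Matrix.mul_assoc, hprojM]
  have hsstar : ∀ g, (s g)ᴴ = s g⁻¹ := by
    intro g
    simp only [s, Matrix.conjTranspose_mul, Matrix.conjTranspose_conjTranspose,
      hτ.conjTranspose_eq_inv, Matrix.mul_assoc]
  let σ : UnitaryRep G :=
    { dim := d
      hom :=
        { toFun := fun g => ⟨s g, by
            rw [Matrix.mem_unitaryGroup_iff, Matrix.star_eq_conjTranspose, hsstar, ← hsmul,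
              mul_inv_cancel, hs1]⟩
          map_one' := Subtype.ext hs1
          map_mul' := fun g h => Subtype.ext (hsmul g h) } }
  refine ⟨σ, V, ?_, hVV, fun g => hprojM g, fun u => hle (hVmem u)⟩
  have hnt : Nontrivial (Subrepresentation σ.toRepresentation) := by
    refine ⟨⊥, ⊤, fun hbt => h0' ?_⟩
    have hbt' : (⊥ : Submodule ℂ (Fin σ.dim → ℂ)) = ⊤ :=
      congrArg Subrepresentation.toSubmodule hbt
    rw [eq_bot_iff]
    intro w hw
    have : Vᴴ *ᵥ w ∈ (⊥ : Submodule ℂ (Fin σ.dim → ℂ)) := hbt' ▸ Submodule.mem_top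
    rw [Submodule.mem_bot] at this
    rw [Submodule.mem_bot, ← hproj w hw, this, Matrix.mulVec_zero]
  refine { eq_bot_or_eq_top := fun X => ?_ }
  let Y : Submodule ℂ (m → ℂ) := X.toSubmodule.map V.mulVecLin
  have hYinv : ∀ g, ∀ v ∈ Y, τ g *ᵥ v ∈ Y := by
    rintro g _ ⟨x, hx, rfl⟩
    refine ⟨s g *ᵥ x, X.apply_mem_toSubmodule g hx, ?_⟩
    simp only [s, Matrix.mulVecLin_apply]
    rw [Matrix.mulVec_mulVec, Matrix.mulVec_mulVec, hprojM]
  have hYle : Y ≤ W' := by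
    rintro _ ⟨x, hx, rfl⟩
    exact hVmem x
  have hback : ∀ x : Fin σ.dim → ℂ, V *ᵥ x ∈ Y → x ∈ X.toSubmodule := by
    rintro x ⟨x', hx', h⟩
    have := congrArg (Vᴴ *ᵥ ·) h
    simp only [Matrix.mulVecLin_apply, Matrix.mulVec_mulVec, hVV, Matrix.one_mulVec] at this
    exact this ▸ hx'
  by_cases hY : Y = ⊥
  · left
    apply Subrepresentation.toSubmodule_injective
    change X.toSubmodule = ⊥
    rw [eq_bot_iff]
    intro x hx
    have h1 : V *ᵥ x ∈ Y := ⟨x, hx, rfl⟩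
    rw [hY, Submodule.mem_bot] at h1
    have := congrArg (Vᴴ *ᵥ ·) h1
    simpa only [Matrix.mulVec_mulVec, hVV, Matrix.one_mulVec, Matrix.mulVec_zero,
      Submodule.mem_bot] using this
  · right
    have hYW : Y = W' := by
      by_contra hne
      exact hmin Y ⟨hY, hYinv, hYle.trans hle⟩ (lt_of_le_of_ne hYle hne)
    apply Subrepresentation.toSubmodule_injective
    change X.toSubmodule = ⊤
    rw [eq_top_iff]
    intro x _
    exact hback x (hYW ▸ hVmem x)

end Reps

namespace Dual

variable {G : Type*} [Group G] (D : Dual G) {m : Type*} [Fintype m] [DecidableEq m]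

/-- Complete reducibility: a unitary representation is spanned by the ranges of the intertwiners
from the members of the dual. -/
theorem eq_zero_of_forall_intertwiner {τ : G → Matrix m m ℂ} (hτ : IsUnitaryMatRep τ) (w : m → ℂ)
    (hw : ∀ π : D.Idx, ∀ S ∈ intertwiners (D.rep π).mat τ, Sᴴ *ᵥ w = 0) : w = 0 := by
  let W : Submodule ℂ (m → ℂ) :=
    { carrier := {w | ∀ π : D.Idx, ∀ S ∈ intertwiners (D.rep π).mat τ, Sᴴ *ᵥ w = 0}
      add_mem' := fun ha hb π S hS => by rw [Matrix.mulVec_add, ha π S hS, hb π S hS, add_zero]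
      zero_mem' := fun π S _ => Matrix.mulVec_zero _
      smul_mem' := fun c a ha π S hS => by rw [Matrix.mulVec_smul, ha π S hS, smul_zero] }
  suffices h : W = ⊥ by
    have : w ∈ W := hw
    rwa [h, Submodule.mem_bot] at this
  by_contra h0
  obtain ⟨σ, V, hσ, hVV, hV, hVW⟩ := hτ.exists_irreducible W (fun g v hv π S hS => by
    rw [Matrix.mulVec_mulVec,
      hτ.conjTranspose_mem_intertwiners (D.rep π).isUnitaryMatRep hS g, ← Matrix.mulVec_mulVec,
      hv π S hS, Matrix.mulVec_zero]) h0
  obtain ⟨π, U, hU1, hU2, hU⟩ := D.complete σ hσ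
  have hS : V * U ∈ intertwiners (D.rep π).mat τ := fun g => by
    rw [Matrix.mul_assoc, hU g, ← Matrix.mul_assoc, hV g, Matrix.mul_assoc]
  have hSS : (V * U)ᴴ * (V * U) = 1 := by
    rw [Matrix.conjTranspose_mul, Matrix.mul_assoc, ← Matrix.mul_assoc Vᴴ, hVV, Matrix.one_mul,
      hU1]
  have hz : ∀ u, u = (0 : Fin (D.rep π).dim → ℂ) := fun u => by
    have := hVW (U *ᵥ u) π _ hS
    rwa [Matrix.mulVec_mulVec _ V, Matrix.mulVec_mulVec, hSS, Matrix.one_mulVec] at this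
  have h1 := hz fun _ => 1
  exact one_ne_zero (congrFun h1 ⟨0, (D.rep π).dim_pos (D.irreducible π)⟩)

/-- Complete reducibility in terms of the conjugates of the members of the dual. -/
theorem eq_zero_of_forall_intertwiner_conj {τ : G → Matrix m m ℂ} (hτ : IsUnitaryMatRep τ)
    (w : m → ℂ)
    (hw : ∀ π : D.Idx, ∀ S ∈ intertwiners (D.rep π).conjMat τ, Sᴴ *ᵥ w = 0) : w = 0 := by
  have h := D.eq_zero_of_forall_intertwiner hτ.map_star (star w) fun π S hS => by
    have h1 : S.map star ∈ intertwiners (D.rep π).conjMat τ := fun g => by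
      have := congrArg (fun A => A.map (starRingEnd ℂ)) (hS g)
      simp only [Matrix.map_mul] at this
      refine this.trans ?_
      congr 1
      ext i j
      simp
    have h2 := hw π _ h1
    have h3 := congrArg star h2
    rw [star_zero, Matrix.star_mulVec] at h3
    rw [← h3, Matrix.conjTranspose_conjTranspose, ← Matrix.mulVec_transpose]
    rfl
  rw [← star_star w, h, star_zero]

end Dual

/-! ### Schur orthogonality -/

section Schur

variable {G : Type*} [Group G]

/-- Schur's lemma: a matrix commuting with an irreducible representation is scalar. -/
theorem UnitaryRep.exists_eq_smul_one (π : UnitaryRep G) (h : π.toRepresentation.IsIrreducible)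
    {A : Matrix (Fin π.dim) (Fin π.dim) ℂ} (hA : A ∈ intertwiners π.mat π.mat) :
    ∃ c : ℂ, A = c • (1 : Matrix (Fin π.dim) (Fin π.dim) ℂ) := by
  have : Nonempty (Fin π.dim) := ⟨⟨0, π.dim_pos h⟩⟩
  obtain ⟨c, hc⟩ := Module.End.exists_eigenvalue (Matrix.toLin' A)
  have hmem : ∀ v, v ∈ Module.End.eigenspace (Matrix.toLin' A) c ↔ A *ᵥ v = c • v := fun v => by
    rw [Module.End.mem_eigenspace_iff, Matrix.toLin'_apply]
  rcases π.eq_bot_or_eq_top h (Module.End.eigenspace (Matrix.toLin' A) c) (fun g v hv => by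
    rw [hmem] at hv ⊢
    rw [Matrix.mulVec_mulVec, hA g, ← Matrix.mulVec_mulVec, hv, Matrix.mulVec_smul]) with h0 | h0
  · exact absurd h0 hc
  · refine ⟨c, Matrix.ext_of_mulVec_single fun k => ?_⟩
    rw [Matrix.smul_mulVec, Matrix.one_mulVec]
    exact (hmem _).1 (h0 ▸ Submodule.mem_top)

namespace Dual

variable (D : Dual G)

theorem dim_ne_zero (π : D.Idx) : (D.dim π : ℂ) ≠ 0 := by
  exact_mod_cast ((D.rep π).dim_pos (D.irreducible π)).ne'

open scoped ComplexOrder in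
/-- Schur's lemma: there are no nonzero intertwiners between different members of the dual. -/
theorem intertwiner_eq_zero {σ π : D.Idx} (hne : σ ≠ π)
    {S : Matrix (Fin (D.dim π)) (Fin (D.dim σ)) ℂ}
    (hS : S ∈ intertwiners (D.rep σ).mat (D.rep π).mat) : S = 0 := by
  have hS' := (D.rep π).isUnitaryMatRep.conjTranspose_mem_intertwiners
    (D.rep σ).isUnitaryMatRep hS
  obtain ⟨c, hc⟩ := (D.rep σ).exists_eq_smul_one (D.irreducible σ) (A := Sᴴ * S) fun g => by
    rw [Matrix.mul_assoc, hS g, ← Matrix.mul_assoc, hS' g, Matrix.mul_assoc]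
  obtain ⟨c', hc'⟩ := (D.rep π).exists_eq_smul_one (D.irreducible π) (A := S * Sᴴ) fun g => by
    rw [Matrix.mul_assoc, hS' g, ← Matrix.mul_assoc, hS g, Matrix.mul_assoc]
  by_contra h0
  -- `S S* S` computed in two ways shows that both scalars agree.
  have hcc : c = c' := by
    have h1 : c • S = c' • S := by
      calc c • S = S * (Sᴴ * S) := by rw [hc, Matrix.mul_smul, Matrix.mul_one]
        _ = (S * Sᴴ) * S := by rw [Matrix.mul_assoc]
        _ = c' • S := by rw [hc', Matrix.smul_mul, Matrix.one_mul]
    exact smul_left_injective _ h0 h1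
  have hne0 : Sᴴ * S ≠ 0 := fun h => h0 (Matrix.conjTranspose_mul_self_eq_zero.1 h)
  let i : Fin (D.dim σ) := ⟨0, (D.rep σ).dim_pos (D.irreducible σ)⟩
  -- The scalar is a diagonal entry of `S* S`, hence nonnegative.
  have hcr : c = ((∑ j, ‖S j i‖ ^ 2 : ℝ) : ℂ) := by
    have h1 : (Sᴴ * S) i i = c := by rw [hc]; simp
    rw [← h1, Matrix.mul_apply]
    push_cast
    refine Finset.sum_congr rfl fun j _ => ?_
    rw [Matrix.conjTranspose_apply]
    exact RCLike.conj_mul (S j i)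
  set r : ℝ := ∑ j, ‖S j i‖ ^ 2 with hr
  have hr0 : 0 < r := by
    refine lt_of_le_of_ne (Finset.sum_nonneg fun j _ => by positivity) fun h => hne0 ?_
    rw [hc, hcr, ← h, Complex.ofReal_zero, zero_smul]
  have hs : (((√r)⁻¹ : ℝ) : ℂ) * (((√r)⁻¹ : ℝ) : ℂ) * c = 1 := by
    rw [hcr, ← Complex.ofReal_mul, ← Complex.ofReal_mul, ← mul_inv, Real.mul_self_sqrt hr0.le,
      inv_mul_cancel₀ hr0.ne', Complex.ofReal_one]
  refine hne (D.inequivalent σ π ⟨(((√r)⁻¹ : ℝ) : ℂ) • S, ?_, ?_, fun g => ?_⟩)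
  · rw [Matrix.conjTranspose_smul, Matrix.smul_mul, Matrix.mul_smul, hc, smul_smul, smul_smul,
      Complex.star_def, Complex.conj_ofReal, hs, one_smul]
  · rw [Matrix.conjTranspose_smul, Matrix.smul_mul, Matrix.mul_smul, hc', ← hcc, smul_smul,
      smul_smul, Complex.star_def, Complex.conj_ofReal, hs, one_smul]
  · rw [Matrix.smul_mul, hS g, Matrix.mul_smul]

variable [Fintype G]

theorem average_mem_intertwiners (σ π : D.Idx) (X : Matrix (Fin (D.dim π)) (Fin (D.dim σ)) ℂ) :
    ∑ g, (D.rep π).mat g * X * ((D.rep σ).mat g)ᴴ ∈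
      intertwiners (D.rep σ).mat (D.rep π).mat := by
  intro h
  have hσ := (D.rep σ).isUnitaryMatRep
  have hπ := (D.rep π).isUnitaryMatRep
  rw [Matrix.sum_mul, Matrix.mul_sum]
  refine Fintype.sum_equiv (Equiv.mulLeft h⁻¹) _ _ fun g => ?_
  simp only [Equiv.coe_mulLeft, hσ.conjTranspose_eq_inv]
  rw [Matrix.mul_assoc, ← hσ.mul, ← Matrix.mul_assoc, ← Matrix.mul_assoc, ← hπ.mul,
    mul_inv_cancel_left, mul_inv_rev, inv_inv]

/-- Schur orthogonality for different members of the dual. -/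
theorem sum_mat_mul_star_of_ne {σ π : D.Idx} (hne : σ ≠ π) (i j : Fin (D.dim π))
    (k l : Fin (D.dim σ)) :
    ∑ g, (D.rep π).mat g i j * star ((D.rep σ).mat g k l) = 0 := by
  have h := congrFun (congrFun (D.intertwiner_eq_zero hne
    (D.average_mem_intertwiners σ π (Matrix.single j l 1))) i) k
  rw [Matrix.sum_apply] at h
  rw [Matrix.zero_apply] at h
  rw [← h]
  refine Finset.sum_congr rfl fun g _ => ?_
  simp [Matrix.mul_apply, Matrix.single_apply, ite_and]

/-- Schur orthogonality for the coefficients of one member of the dual. -/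
theorem sum_mat_mul_star_self (π : D.Idx) (i j k l : Fin (D.dim π)) :
    ∑ g, (D.rep π).mat g i j * star ((D.rep π).mat g k l) =
      if i = k ∧ j = l then (Fintype.card G : ℂ) / D.dim π else 0 := by
  obtain ⟨c, hc⟩ := (D.rep π).exists_eq_smul_one (D.irreducible π)
    (D.average_mem_intertwiners π π (Matrix.single j l 1))
  have h := congrFun (congrFun hc i) k
  have ht := congrArg Matrix.trace hc
  have hN : (D.dim π : ℂ) * c = if j = l then (Fintype.card G : ℂ) else 0 := by
    rw [Matrix.trace_smul, Matrix.trace_one, Matrix.trace_sum] at ht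
    rw [mul_comm]
    simp only [Fintype.card_fin, smul_eq_mul] at ht
    rw [← ht]
    have : ∀ g, ((D.rep π).mat g * Matrix.single j l 1 * ((D.rep π).mat g)ᴴ).trace =
        if j = l then (1 : ℂ) else 0 := fun g => by
      rw [Matrix.trace_mul_comm, ← Matrix.mul_assoc,
        (D.rep π).isUnitaryMatRep.conjTranspose_mul_self, Matrix.one_mul]
      split_ifs with hjl
      · rw [hjl, Matrix.trace_single_eq_same]
      · rw [Matrix.trace_single_eq_of_ne _ _ _ hjl]
    simp only [this]
    split_ifs <;> simp
  have hc' : c = if j = l then (Fintype.card G : ℂ) / D.dim π else 0 := by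
    have hd := D.dim_ne_zero π
    split_ifs at hN ⊢ with hjl
    · rw [← hN]; field_simp
    · exact (mul_eq_zero.1 hN).resolve_left hd
  rw [Matrix.sum_apply, Matrix.smul_apply, Matrix.one_apply] at h
  have h2 : ∑ g, (D.rep π).mat g i j * star ((D.rep π).mat g k l) =
      c • if i = k then (1 : ℂ) else 0 := by
    rw [← h]
    refine Finset.sum_congr rfl fun g _ => ?_
    simp [Matrix.mul_apply, Matrix.single_apply, ite_and]
  rw [h2, hc']
  by_cases h1 : i = k <;> by_cases h2 : j = l <;> simp [h1, h2]

/-- The coefficients of a nontrivial member of the dual have mean zero. -/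
theorem sum_mat_eq_zero {π : D.Idx} (hπ : π ≠ D.one) (i j : Fin (D.dim π)) :
    ∑ g, (D.rep π).mat g i j = 0 := by
  have h1 : 0 < D.dim D.one := (D.rep D.one).dim_pos (D.irreducible D.one)
  have h := D.sum_mat_mul_star_of_ne hπ.symm i j ⟨0, h1⟩ ⟨0, h1⟩
  rw [← h]
  refine Finset.sum_congr rfl fun g _ => ?_
  have : (D.rep D.one).mat g = 1 := by
    rw [D.rep_one]
    exact congrArg Subtype.val (MonoidHom.one_apply g)
  rw [this, Matrix.one_apply_eq, star_one, mul_one]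

/-- The coefficients of the members of the dual span the functions on `G`. -/
theorem eq_zero_of_forall_sum_smul_mat_eq_zero (f : G → ℂ)
    (hf : ∀ π : D.Idx, ∑ g, f g • (D.rep π).mat g = 0) : f = 0 := by
  classical
  let τ : G → Matrix G G ℂ := fun g => Matrix.of fun x y => if x = g * y then 1 else 0
  have hτ : IsUnitaryMatRep τ :=
    { one := by ext x y; simp [τ, Matrix.one_apply]
      mul := fun g h => by
        ext x y
        simp [τ, Matrix.mul_apply, mul_assoc]
      conjTranspose_mul_self := fun g => by
        ext x y
        simp [τ, Matrix.mul_apply, Matrix.one_apply, apply_ite, eq_comm] }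
  -- The operator of the left regular representation given by `f` vanishes on the range of every
  -- intertwiner from the dual, and its column at `1` is `f`.
  have hA : (∑ g, f g • τ g)ᴴ = 0 := by
    refine Matrix.ext_of_mulVec_single fun x => ?_
    rw [Matrix.zero_mulVec]
    refine D.eq_zero_of_forall_intertwiner hτ _ fun π S hS => ?_
    rw [Matrix.mulVec_mulVec, ← Matrix.conjTranspose_mul]
    have : (∑ g, f g • τ g) * S = 0 := by
      calc (∑ g, f g • τ g) * S = ∑ g, f g • (τ g * S) := by
            rw [Matrix.sum_mul]
            exact Finset.sum_congr rfl fun g _ => Matrix.smul_mul _ _ _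
        _ = ∑ g, S * (f g • (D.rep π).mat g) :=
            Finset.sum_congr rfl fun g _ => by rw [← hS g, Matrix.mul_smul]
        _ = 0 := by rw [← Matrix.mul_sum, hf π, Matrix.mul_zero]
    rw [this, Matrix.conjTranspose_zero, Matrix.zero_mulVec]
  rw [Matrix.conjTranspose_eq_zero] at hA
  funext x
  have h := congrFun (congrFun hA x) 1
  rw [Matrix.sum_apply] at h
  simpa [τ] using h

/-! ### The Fourier transform -/

/-- The matrix of the Fourier transform `ℓ²(G) → ℓ²(Ĝ)`, with entries
`(dρ / |G|)^{1/2} conj ρ(g)_{ij}`. -/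
def fourier : Matrix D.Coeff G ℂ :=
  fun a g => ((√((D.dim a.1 : ℝ) / Fintype.card G) : ℝ) : ℂ) * (D.rep a.1).conjMat g a.2.1 a.2.2

theorem fourier_mul_conjTranspose : D.fourier * D.fourierᴴ = 1 := by
  ext ⟨ρ, i, j⟩ ⟨σ, k, l⟩
  have hN : (Fintype.card G : ℂ) ≠ 0 := by simp
  have h1 : (D.fourier * D.fourierᴴ) ⟨ρ, i, j⟩ ⟨σ, k, l⟩ =
      ((√((D.dim ρ : ℝ) / Fintype.card G) : ℝ) : ℂ) *
        ((√((D.dim σ : ℝ) / Fintype.card G) : ℝ) : ℂ) *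
          ∑ g, (D.rep σ).mat g k l * star ((D.rep ρ).mat g i j) := by
    rw [Matrix.mul_apply, Finset.mul_sum]
    refine Finset.sum_congr rfl fun g _ => ?_
    simp only [Matrix.conjTranspose_apply, fourier, UnitaryRep.conjMat, Matrix.map_apply,
      star_mul', Complex.star_def, Complex.conj_ofReal, Complex.conj_conj]
    ring
  rw [h1]
  by_cases h : ρ = σ
  · subst h
    rw [D.sum_mat_mul_star_self, ← Complex.ofReal_mul, Real.mul_self_sqrt (by positivity)]
    have hd := D.dim_ne_zero ρ
    by_cases h2 : k = i ∧ l = j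
    · obtain ⟨rfl, rfl⟩ := h2
      rw [if_pos ⟨rfl, rfl⟩, Matrix.one_apply_eq]
      push_cast
      field_simp
    · rw [if_neg h2, mul_zero, Matrix.one_apply_ne]
      intro h3
      simp only [Sigma.mk.injEq, heq_eq_eq, Prod.mk.injEq, true_and] at h3
      exact h2 ⟨h3.1.symm, h3.2.symm⟩
  · rw [D.sum_mat_mul_star_of_ne h, mul_zero, Matrix.one_apply_ne]
    intro h3
    exact h (congrArg Sigma.fst h3)

/-- The Fourier transform is isometric, since the coefficients of the members of the dual span
the functions on `G`. -/
theorem conjTranspose_fourier_mul [DecidableEq G] : D.fourierᴴ * D.fourier = 1 := by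
  have hinj : ∀ f : G → ℂ, D.fourier *ᵥ f = 0 → f = 0 := by
    intro f hf
    have h := D.eq_zero_of_forall_sum_smul_mat_eq_zero (star f) fun π => by
      ext i j
      have h1 := congrFun hf ⟨π, i, j⟩
      have h2 : ((√((D.dim π : ℝ) / Fintype.card G) : ℝ) : ℂ) *
          ∑ g, (D.rep π).conjMat g i j * f g = 0 := by
        rw [← h1.trans (Pi.zero_apply _), Finset.mul_sum]
        exact Finset.sum_congr rfl fun g _ => (mul_assoc _ _ _).symm
      have hd : (0 : ℝ) < D.dim π := by exact_mod_cast (D.rep π).dim_pos (D.irreducible π)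
      have h3 := (mul_eq_zero.1 h2).resolve_left
        (Complex.ofReal_ne_zero.2 (Real.sqrt_pos.2 (by positivity)).ne')
      have h4 := congrArg star h3
      rw [star_zero, star_sum] at h4
      rw [Matrix.sum_apply, Matrix.zero_apply, ← h4]
      refine Finset.sum_congr rfl fun g _ => ?_
      simp [UnitaryRep.conjMat, mul_comm]
    rw [← star_star f, h, star_zero]
  have hU : D.fourier * (D.fourierᴴ * D.fourier - 1) = 0 := by
    rw [Matrix.mul_sub, ← Matrix.mul_assoc, D.fourier_mul_conjTranspose, Matrix.one_mul,
      Matrix.mul_one, sub_self]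
  refine sub_eq_zero.1 (Matrix.ext_of_mulVec_single fun g => ?_)
  rw [Matrix.zero_mulVec]
  exact hinj _ (by rw [Matrix.mulVec_mulVec, hU, Matrix.zero_mulVec])

end Dual

end Schur

/-! ### The canonical representation is multiplication by matrix coefficients -/

section Canonical

variable {G : Type*} [Group G] {D : Dual G}

theorem UnitaryRep.map_star_mem_intertwiners {σ π : UnitaryRep G}
    {S : Matrix (Fin π.dim) (Fin σ.dim) ℂ} (hS : S ∈ intertwiners σ.conjMat π.conjMat) :
    S.map star ∈ intertwiners σ.mat π.mat := fun g => by
  have := congrArg (fun A => A.map (starRingEnd ℂ)) (hS g)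
  simp only [Matrix.map_mul] at this
  have e : ∀ ρ : UnitaryRep G, (ρ.conjMat g).map (starRingEnd ℂ) = ρ.mat g := fun ρ => by
    ext i j
    simp [UnitaryRep.conjMat]
  rw [e, e] at this
  exact this

/-- The isometries belonging to different constituents of `ρ̄ ⊗ π` have orthogonal ranges. -/
theorem conjTranspose_mul_of_ne (T : BasisChoice D) (ρ π : D.Idx) {σ σ' : D.Idx} (hne : σ ≠ σ')
    (e : Fin (T ρ π σ).mult) (e' : Fin (T ρ π σ').mult) :
    ((T ρ π σ').T e')ᴴ * (T ρ π σ).T e = 0 := by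
  have hτ := ((D.rep ρ).isUnitaryMatRep_conjMat).kronecker (D.rep π).isUnitaryMatRep
  have h1 := (T ρ π σ).mem e
  have h2 := hτ.conjTranspose_mem_intertwiners (D.rep σ').isUnitaryMatRep_conjMat
    ((T ρ π σ').mem e')
  have h := D.intertwiner_eq_zero hne (UnitaryRep.map_star_mem_intertwiners
    (S := ((T ρ π σ').T e')ᴴ * (T ρ π σ).T e) fun g => by
      rw [Matrix.mul_assoc, h1 g, ← Matrix.mul_assoc, h2 g, Matrix.mul_assoc])
  ext i j
  have := congrFun (congrFun h i) j
  rwa [Matrix.map_apply, Matrix.zero_apply, star_eq_zero] at this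

/-- The isometries `T_{ρ̄,π}^{σ̄,e}` decompose `ρ̄ ⊗ π` completely. -/
theorem sum_basis_mul_conjTranspose (T : BasisChoice D) (ρ π : D.Idx) :
    ∑ σ, ∑ e, (T ρ π σ).T e * ((T ρ π σ).T e)ᴴ = 1 := by
  have hτ := ((D.rep ρ).isUnitaryMatRep_conjMat).kronecker (D.rep π).isUnitaryMatRep
  set P := ∑ σ, ∑ e, (T ρ π σ).T e * ((T ρ π σ).T e)ᴴ with hP
  have hTP : ∀ σ e, ((T ρ π σ).T e)ᴴ * P = ((T ρ π σ).T e)ᴴ := by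
    intro σ e
    rw [hP, Matrix.mul_sum, Finset.sum_eq_single σ]
    · rw [Matrix.mul_sum, Finset.sum_eq_single e]
      · rw [← Matrix.mul_assoc, (T ρ π σ).orthonormal, if_pos rfl, Matrix.one_mul]
      · intro f _ hf
        rw [← Matrix.mul_assoc, (T ρ π σ).orthonormal, if_neg hf.symm, Matrix.zero_mul]
      · exact fun h => absurd (Finset.mem_univ _) h
    · intro σ' _ hσ
      rw [Matrix.mul_sum]
      refine Finset.sum_eq_zero fun f _ => ?_
      rw [← Matrix.mul_assoc, conjTranspose_mul_of_ne T ρ π hσ, Matrix.zero_mul]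
    · exact fun h => absurd (Finset.mem_univ _) h
  refine (sub_eq_zero.1 (Matrix.ext_of_mulVec_single fun k => ?_)).symm
  rw [Matrix.zero_mulVec]
  refine D.eq_zero_of_forall_intertwiner_conj hτ _ fun σ S hS => ?_
  rw [Matrix.mulVec_mulVec]
  suffices h : Sᴴ * (1 - P) = 0 by rw [h, Matrix.zero_mulVec]
  rw [← (T ρ π σ).span] at hS
  induction hS using Submodule.span_induction with
  | mem S hS =>
    obtain ⟨e, rfl⟩ := hS
    rw [Matrix.mul_sub, hTP, Matrix.mul_one, sub_self]
  | zero => rw [Matrix.conjTranspose_zero, Matrix.zero_mul]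
  | add S S' _ _ h h' => rw [Matrix.conjTranspose_add, Matrix.add_mul, h, h', add_zero]
  | smul c S _ h => rw [Matrix.conjTranspose_smul, Matrix.smul_mul, h, smul_zero]

/-- The family `ρ ↦ ρ̄(g)` is an eigenvector of `λ_{π_{ij}}` with eigenvalue `π(g)_{ij}`. -/
theorem lambdaOp_conjMat (T : BasisChoice D) (π : D.Idx) (i j : Fin (D.dim π)) (g : G) :
    lambdaOp T π i j (fun ρ => (D.rep ρ).conjMat g) =
      (D.rep π).mat g i j • fun ρ => (D.rep ρ).conjMat g := by
  funext ρ
  have h1 : ∑ σ, ∑ e, (T ρ π σ).T e * (D.rep σ).conjMat g * ((T ρ π σ).T e)ᴴ =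
      (D.rep ρ).conjMat g ⊗ₖ (D.rep π).mat g := by
    rw [← Matrix.mul_one ((D.rep ρ).conjMat g ⊗ₖ (D.rep π).mat g),
      ← sum_basis_mul_conjTranspose T ρ π, Matrix.mul_sum]
    refine Finset.sum_congr rfl fun σ _ => ?_
    rw [Matrix.mul_sum]
    refine Finset.sum_congr rfl fun e _ => ?_
    rw [(T ρ π σ).mem e g, Matrix.mul_assoc]
  ext k l
  have h2 := congrFun (congrFun h1 (k, i)) (l, j)
  rw [Matrix.kronecker_apply, mul_comm] at h2
  refine Eq.trans ?_ h2
  simp only [lambdaOp, Matrix.sum_apply]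
  rfl

theorem lambdaOp_sum_smul {ι : Type*} (s : Finset ι) (T : BasisChoice D) (π : D.Idx)
    (i j : Fin (D.dim π)) (c : ι → ℂ) (v : ι → EllTwo D) :
    lambdaOp T π i j (∑ b ∈ s, c b • v b) = ∑ b ∈ s, c b • lambdaOp T π i j (v b) := by
  funext ρ
  simp only [lambdaOp, Finset.sum_apply, Pi.smul_apply, Matrix.mul_sum, Matrix.sum_mul,
    Matrix.mul_smul, Matrix.smul_mul, Finset.smul_sum]
  symm
  rw [Finset.sum_comm]
  exact Finset.sum_congr rfl fun σ _ => Finset.sum_comm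

theorem ellInner_sum_smul {ι : Type*} (s : Finset ι) (c : ι → ℂ) (v : ι → EllTwo D)
    (w : EllTwo D) : ellInner (∑ b ∈ s, c b • v b) w = ∑ b ∈ s, c b * ellInner (v b) w := by
  simp only [ellInner, Finset.sum_apply, Pi.smul_apply, Matrix.trace_sum, Matrix.mul_smul,
    Matrix.trace_smul, Finset.mul_sum, smul_eq_mul]
  rw [Finset.sum_comm]
  refine Finset.sum_congr rfl fun b _ => Finset.sum_congr rfl fun π _ => ?_
  ring

theorem ellInner_ellBasis (v : EllTwo D) (a : D.Coeff) :
    ellInner v (ellBasis a) = ((√(D.dim a.1 : ℝ) : ℝ) : ℂ) * v a.1 a.2.1 a.2.2 := by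
  obtain ⟨π, i, j⟩ := a
  have hd : (0 : ℝ) < D.dim π := by exact_mod_cast (D.rep π).dim_pos (D.irreducible π)
  have hs : (D.dim π : ℂ) * (((√(D.dim π : ℝ))⁻¹ : ℝ) : ℂ) = ((√(D.dim π : ℝ) : ℝ) : ℂ) := by
    have : (D.dim π : ℝ) * (√(D.dim π : ℝ))⁻¹ = √(D.dim π : ℝ) := by
      rw [mul_inv_eq_iff_eq_mul₀ (Real.sqrt_pos.2 hd).ne', Real.mul_self_sqrt hd.le]
    exact_mod_cast congrArg (fun x : ℝ => (x : ℂ)) this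
  rw [ellInner, Finset.sum_eq_single π]
  · simp only [ellBasis, Pi.single_eq_same, Matrix.conjTranspose_smul, Matrix.conjTranspose_single,
      Matrix.smul_mul, Matrix.trace_smul, star_one, Complex.star_def, Complex.conj_ofReal,
      smul_eq_mul]
    rw [← mul_assoc, hs, Matrix.trace_single_mul, one_smul]
  · intro ρ _ hρ
    simp [ellBasis, Pi.single_eq_of_ne hρ]
  · exact fun h => absurd (Finset.mem_univ _) h

theorem lambdaOp_smul (T : BasisChoice D) (π : D.Idx) (i j : Fin (D.dim π)) (c : ℂ)
    (v : EllTwo D) : lambdaOp T π i j (c • v) = c • lambdaOp T π i j v := by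
  simpa using lambdaOp_sum_smul {()} T π i j (fun _ => c) (fun _ => v)

theorem ellInner_smul (c : ℂ) (v w : EllTwo D) : ellInner (c • v) w = c * ellInner v w := by
  simpa using ellInner_sum_smul {()} (fun _ => c) (fun _ => v) w

variable [Fintype G]

/-- The columns of the Fourier matrix are the normalized eigenvectors `ρ ↦ ρ̄(g)`. -/
theorem sum_fourier_smul_ellBasis (g : G) :
    ∑ b, D.fourier b g • ellBasis b =
      (((√(Fintype.card G : ℝ))⁻¹ : ℝ) : ℂ) • fun ρ => (D.rep ρ).conjMat g := by
  funext ρ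
  ext k l
  have hd : (0 : ℝ) < D.dim ρ := by exact_mod_cast (D.rep ρ).dim_pos (D.irreducible ρ)
  have hs : ((√((D.dim ρ : ℝ) / Fintype.card G) : ℝ) : ℂ) * (((√(D.dim ρ : ℝ))⁻¹ : ℝ) : ℂ) =
      (((√(Fintype.card G : ℝ))⁻¹ : ℝ) : ℂ) := by
    rw [← Complex.ofReal_mul, Real.sqrt_div hd.le]
    have := (Real.sqrt_pos.2 hd).ne'
    congr 1
    field_simp
  rw [Finset.sum_apply, Matrix.sum_apply, Finset.sum_eq_single ⟨ρ, k, l⟩]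
  · simp only [Pi.smul_apply, Matrix.smul_apply, ellBasis, Pi.single_eq_same,
      Matrix.single_apply_same, smul_eq_mul, mul_one, Dual.fourier]
    rw [mul_right_comm, hs]
  · rintro ⟨σ, k', l'⟩ _ hne
    simp only [Pi.smul_apply, Matrix.smul_apply, ellBasis, smul_eq_mul]
    by_cases h : ρ = σ
    · subst h
      rw [Pi.single_eq_same, Matrix.smul_apply, Matrix.single_apply_of_ne, smul_zero, mul_zero]
      rintro ⟨rfl, rfl⟩
      exact hne rfl
    · rw [Pi.single_eq_of_ne h, Matrix.zero_apply, mul_zero]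
  · exact fun h => absurd (Finset.mem_univ _) h

variable [DecidableEq G]

variable (D) in
/-- Multiplication by the function `f` on `G`, transported to `ℓ²(Ĝ)` by the Fourier transform. -/
def multMat (f : G → ℂ) : Matrix D.Coeff D.Coeff ℂ :=
  D.fourier * Matrix.diagonal f * D.fourierᴴ

theorem multMat_mul (f f' : G → ℂ) : multMat D (f * f') = multMat D f * multMat D f' := by
  have h : Matrix.diagonal (f * f') =
      Matrix.diagonal f * (D.fourierᴴ * D.fourier) * Matrix.diagonal f' := by
    rw [D.conjTranspose_fourier_mul, Matrix.mul_one]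
    exact (Matrix.diagonal_mul_diagonal f f').symm
  rw [multMat, h]
  simp only [multMat, Matrix.mul_assoc]

variable (D) in
/-- The algebra of functions on `G`, acting on `ℓ²(Ĝ)` by multiplication. -/
def multHom : (G → ℂ) →⋆ₐ[ℂ] Matrix D.Coeff D.Coeff ℂ where
  toFun := multMat D
  map_one' := by
    have : Matrix.diagonal (1 : G → ℂ) = 1 := Matrix.diagonal_one
    rw [multMat, this, Matrix.mul_one, D.fourier_mul_conjTranspose]
  map_zero' := by
    have : Matrix.diagonal (0 : G → ℂ) = 0 := Matrix.diagonal_zero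
    rw [multMat, this, Matrix.mul_zero, Matrix.zero_mul]
  map_mul' := multMat_mul
  map_add' f f' := by
    have : Matrix.diagonal (f + f') = Matrix.diagonal f + Matrix.diagonal f' :=
      (Matrix.diagonal_add f f').symm
    rw [multMat, this, Matrix.mul_add, Matrix.add_mul]
    rfl
  commutes' c := by
    have : Matrix.diagonal (algebraMap ℂ (G → ℂ) c) = c • (1 : Matrix G G ℂ) := by
      rw [Matrix.smul_one_eq_diagonal]
      rfl
    rw [multMat, this, Matrix.mul_smul, Matrix.smul_mul, Matrix.mul_one,
      D.fourier_mul_conjTranspose, Algebra.algebraMap_eq_smul_one]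
  map_star' f := by
    have : Matrix.diagonal (star f) = (Matrix.diagonal f)ᴴ :=
      (Matrix.diagonal_conjTranspose f).symm
    rw [multMat, this, Matrix.star_eq_conjTranspose, multMat, Matrix.conjTranspose_mul,
      Matrix.conjTranspose_mul, Matrix.conjTranspose_conjTranspose, Matrix.mul_assoc]

theorem trace_multHom (f : G → ℂ) : (multHom D f).trace = ∑ g, f g := by
  change (multMat D f).trace = _
  rw [multMat, Matrix.trace_mul_comm, ← Matrix.mul_assoc, D.conjTranspose_fourier_mul,
    Matrix.one_mul, Matrix.trace_diagonal]

/-- The operator `λ_{π_{ij}}` is multiplication by the coefficient `g ↦ π(g)_{ij}`. -/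
theorem lambdaMat_eq_multHom (T : BasisChoice D) (π : D.Idx) (i j : Fin (D.dim π)) :
    lambdaMat T π i j = multHom D fun g => (D.rep π).mat g i j := by
  have h : lambdaMat T π i j * D.fourier =
      D.fourier * Matrix.diagonal fun g => (D.rep π).mat g i j := by
    ext a g
    rw [Matrix.mul_diagonal, Matrix.mul_apply]
    calc ∑ b, lambdaMat T π i j a b * D.fourier b g
        = ellInner (lambdaOp T π i j (∑ b, D.fourier b g • ellBasis b)) (ellBasis a) := by
          rw [lambdaOp_sum_smul, ellInner_sum_smul]
          exact Finset.sum_congr rfl fun b _ => mul_comm _ _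
      _ = (D.rep π).mat g i j * ellInner (∑ b, D.fourier b g • ellBasis b) (ellBasis a) := by
          rw [sum_fourier_smul_ellBasis, lambdaOp_smul, lambdaOp_conjMat, smul_comm, ellInner_smul]
      _ = D.fourier a g * (D.rep π).mat g i j := by
          have hN : ((√((D.dim a.1 : ℝ) / Fintype.card G) : ℝ) : ℂ) =
              (((√(Fintype.card G : ℝ))⁻¹ : ℝ) : ℂ) * ((√(D.dim a.1 : ℝ) : ℝ) : ℂ) := by
            rw [← Complex.ofReal_mul, Real.sqrt_div (by positivity), div_eq_inv_mul]
          rw [mul_comm, sum_fourier_smul_ellBasis, ellInner_smul, ellInner_ellBasis, ← mul_assoc,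
            ← hN]
          rfl
  change _ = multMat D _
  rw [multMat, ← h, Matrix.mul_assoc, D.fourier_mul_conjTranspose, Matrix.mul_one]

end Canonical

/-! ### Finite levels of the algebraic infinite tensor product -/

section AlgTensor

variable {I : Type} [Fintype I] [DecidableEq I]

namespace AlgTensor

theorem mul_apply (a b : AlgTensor I) (n : ℕ) : (a * b).1 n = a.1 n * b.1 n := rfl

theorem star_apply (a : AlgTensor I) (n : ℕ) : (star a).1 n = star (a.1 n) := rfl

theorem one_apply (n : ℕ) : (1 : AlgTensor I).1 n = 1 := rfl

theorem sub_apply (a b : AlgTensor I) (n : ℕ) : (a - b).1 n = a.1 n - b.1 n := rfl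

theorem smul_apply (c : ℂ) (a : AlgTensor I) (n : ℕ) : (c • a).1 n = c • a.1 n := rfl

theorem sum_apply {ι : Type*} (s : Finset ι) (a : ι → AlgTensor I) (n : ℕ) :
    (∑ k ∈ s, a k).1 n = ∑ k ∈ s, (a k).1 n := by
  classical
  induction s using Finset.induction_on with
  | empty => rfl
  | insert k s hk ih =>
    rw [Finset.sum_insert hk, Finset.sum_insert hk, ← ih]
    rfl

end AlgTensor

variable (I) in
/-- The subalgebra `M_I(ℂ)^{⊗ n}` of the algebraic infinite tensor product: the sequences that are
coherent from `n` on. -/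
def levelAlg (n : ℕ) : StarSubalgebra ℂ (AlgTensor I) where
  carrier := {a | ∀ m, n ≤ m → a.1 (m + 1) = tensorLast (a.1 m) 1}
  mul_mem' {a b} ha hb m hm := by
    rw [AlgTensor.mul_apply, AlgTensor.mul_apply, ha m hm, hb m hm, ← tensorLast_mul, mul_one]
  add_mem' {a b} ha hb m hm := by
    change a.1 _ + b.1 _ = tensorLast (a.1 _ + b.1 _) 1
    rw [ha m hm, hb m hm, ← tensorLast_add]
  algebraMap_mem' c m _ := by
    rw [Algebra.algebraMap_eq_smul_one, AlgTensor.smul_apply, AlgTensor.smul_apply,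
      AlgTensor.one_apply, AlgTensor.one_apply, tensorLast_smul, tensorLast_one]
  star_mem' {a} ha m hm := by
    rw [AlgTensor.star_apply, AlgTensor.star_apply, ha m hm, tensorLast_star]

theorem levelAlg_mono {n k : ℕ} (h : n ≤ k) {a : AlgTensor I} (ha : a ∈ levelAlg I n) :
    a ∈ levelAlg I k := fun m hm => ha m (h.trans hm)

theorem exists_mem_levelAlg (a : AlgTensor I) : ∃ n, a ∈ levelAlg I n := a.2

theorem siteAlg_mem_levelAlg (k : ℕ) (b : Matrix I I ℂ) : siteAlg k b ∈ levelAlg I (k + 1) :=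
  fun m hm => by
    change site k b (m + 1) = tensorLast (site k b m) 1
    rw [site, if_neg (by omega)]

theorem siteAlg_apply_succ_self (k : ℕ) (b : Matrix I I ℂ) :
    (siteAlg k b).1 (k + 1) = tensorLast 1 b := by
  change site k b (k + 1) = _
  rw [site, if_pos rfl]

/-- Two elements that are coherent from `N` on and agree at `N` agree from `N` on. -/
theorem eq_of_mem_levelAlg {N : ℕ} {a b : AlgTensor I} (ha : a ∈ levelAlg I N)
    (hb : b ∈ levelAlg I N) (h : a.1 N = b.1 N) : ∀ n, N ≤ n → a.1 n = b.1 n := by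
  intro n hn
  induction n, hn using Nat.le_induction with
  | base => exact h
  | succ n hn ih => rw [ha n hn, hb n hn, ih]

/-- The sequence `x, x ⊗ 1, x ⊗ 1 ⊗ 1, …` starting at level `n`; it is `0` below. -/
def levelSeq (n : ℕ) (x : Level I n) (m : ℕ) : Level I m :=
  if h : n ≤ m then
    Nat.leRecOn (C := fun k => Level I k) h (fun {k} (y : Level I k) => tensorLast y 1) x
  else 0

theorem levelSeq_succ {n m : ℕ} (x : Level I n) (hm : n ≤ m) :
    levelSeq n x (m + 1) = tensorLast (levelSeq n x m) 1 := by
  rw [levelSeq, levelSeq, dif_pos hm, dif_pos (hm.trans m.le_succ)]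
  exact Nat.leRecOn_succ (C := fun k => Level I k) hm x

/-- The element of the algebraic tensor product given by `x ∈ M_I(ℂ)^{⊗ n}`. -/
def liftLevel (n : ℕ) (x : Level I n) : AlgTensor I :=
  ⟨levelSeq n x, n, fun _ hm => levelSeq_succ x hm⟩

theorem liftLevel_mem (n : ℕ) (x : Level I n) : liftLevel n x ∈ levelAlg I n :=
  fun _ hm => levelSeq_succ x hm

theorem liftLevel_apply_self (n : ℕ) (x : Level I n) : (liftLevel n x).1 n = x := by
  change levelSeq n x n = x
  rw [levelSeq, dif_pos le_rfl]
  exact Nat.leRecOn_self (C := fun k => Level I k) x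

section Nonempty

variable [Nonempty I]

theorem normTrace_eq_tau {N : ℕ} {a : AlgTensor I} (ha : a ∈ levelAlg I N) :
    normTrace (a.1 N) = tau a := by
  obtain ⟨K, hK⟩ := tau_eventually a
  have h : ∀ n, N ≤ n → normTrace (a.1 n) = normTrace (a.1 N) := by
    intro n hn
    induction n, hn using Nat.le_induction with
    | base => rfl
    | succ n hn ih => rw [ha n hn, normTrace_tensorLast, ih]
  rw [← hK (N + K) (by omega), h (N + K) (by omega)]

theorem tau_mul_comm (a b : AlgTensor I) : tau (a * b) = tau (b * a) := by
  obtain ⟨K, hK⟩ := tau_eventually (a * b)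
  obtain ⟨L, hL⟩ := tau_eventually (b * a)
  rw [← hK (K + L) (by omega), ← hL (K + L) (by omega), AlgTensor.mul_apply,
    AlgTensor.mul_apply, normTrace, normTrace, Matrix.trace_mul_comm]

theorem norm_sq_eq_re_tau (a : AlgTensor I) : ‖a‖ ^ 2 = (tau (star a * a)).re := by
  rw [@norm_sq_eq_re_inner ℂ, inner_eq_tau]
  rfl

theorem AlgTensor.norm_star (a : AlgTensor I) : ‖star a‖ = ‖a‖ := by
  rw [← sq_eq_sq₀ (norm_nonneg _) (norm_nonneg _), norm_sq_eq_re_tau, norm_sq_eq_re_tau,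
    tau_mul_comm, star_star]

theorem norm_sub_eq_zero {N : ℕ} {a b : AlgTensor I} (h : ∀ n, N ≤ n → a.1 n = b.1 n) :
    ‖a - b‖ = 0 := by
  have h1 : ‖a - b‖ ^ 2 = 0 := by
    obtain ⟨K, hK⟩ := tau_eventually (star (a - b) * (a - b))
    rw [norm_sq_eq_re_tau, ← hK (N + K) (by omega), AlgTensor.mul_apply, AlgTensor.sub_apply,
      h _ (by omega), sub_self, mul_zero]
    simp [normTrace]
  exact pow_eq_zero_iff two_ne_zero |>.1 h1

theorem coe_eq_of_eventually_eq {N : ℕ} {a b : AlgTensor I} (h : ∀ n, N ≤ n → a.1 n = b.1 n) :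
    (a : GNSSpace I) = b := by
  rw [← sub_eq_zero, ← UniformSpace.Completion.coe_sub, ← norm_eq_zero,
    UniformSpace.Completion.norm_coe]
  exact norm_sub_eq_zero h

/-! ### Left and right multiplication on the GNS space -/

variable (I) in
/-- The trace vector of the GNS space. -/
def vac : GNSSpace I := ((1 : AlgTensor I) : GNSSpace I)

theorem clm_ext {f g : GNSSpace I →L[ℂ] GNSSpace I}
    (h : ∀ b : AlgTensor I, f (b : GNSSpace I) = g b) : f = g := by
  ext ξ
  induction ξ using UniformSpace.Completion.induction_on with
  | hp => exact isClosed_eq f.continuous g.continuous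
  | ih b => exact h b

theorem leftMul_coe (a b : AlgTensor I) :
    leftMul a (b : GNSSpace I) = ((a * b : AlgTensor I) : GNSSpace I) :=
  ContinuousLinearMap.completion_apply_coe _ b

theorem leftMul_vac (a : AlgTensor I) : leftMul a (vac I) = (a : GNSSpace I) := by
  rw [vac, leftMul_coe, mul_one]

theorem leftMul_mul (a b : AlgTensor I) : leftMul (a * b) = leftMul a * leftMul b :=
  clm_ext fun c => by
    rw [mul_apply_eq_comp, leftMul_coe, leftMul_coe, leftMul_coe, mul_assoc]

theorem leftMul_add (a b : AlgTensor I) : leftMul (a + b) = leftMul a + leftMul b :=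
  clm_ext fun c => by
    rw [add_apply, leftMul_coe, leftMul_coe, leftMul_coe, add_mul,
      UniformSpace.Completion.coe_add]

theorem leftMul_smul (c : ℂ) (a : AlgTensor I) : leftMul (c • a) = c • leftMul a :=
  clm_ext fun b => by
    rw [smul_apply, leftMul_coe, leftMul_coe, smul_mul_assoc,
      UniformSpace.Completion.coe_smul]

theorem leftMul_one : leftMul (1 : AlgTensor I) = 1 :=
  clm_ext fun b => by rw [leftMul_coe, one_mul, one_apply_eq_self]

theorem leftMul_star (a : AlgTensor I) : leftMul (star a) = star (leftMul a) := by
  rw [ContinuousLinearMap.star_eq_adjoint, ContinuousLinearMap.eq_adjoint_iff]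
  intro ξ η
  induction ξ, η using UniformSpace.Completion.induction_on₂ with
  | hp => exact isClosed_eq (by fun_prop) (by fun_prop)
  | ih b c =>
    rw [leftMul_coe, leftMul_coe, UniformSpace.Completion.inner_coe,
      UniformSpace.Completion.inner_coe, inner_eq_tau, inner_eq_tau, star_mul, star_star,
      mul_assoc]

variable (I) in
/-- Left multiplication as a `*`-homomorphism into `R`. -/
def leftHom : AlgTensor I →⋆ₐ[ℂ] (tensorFactor I).toStarSubalgebra where
  toFun a := ⟨leftMul a, subset_generated _ ⟨a, rfl⟩⟩
  map_one' := Subtype.ext leftMul_one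
  map_mul' a b := Subtype.ext (leftMul_mul a b)
  map_zero' := Subtype.ext (by simpa using leftMul_smul (0 : ℂ) (0 : AlgTensor I))
  map_add' a b := Subtype.ext (leftMul_add a b)
  commutes' c := Subtype.ext (by
    change leftMul (algebraMap ℂ (AlgTensor I) c) = algebraMap ℂ (GNSSpace I →L[ℂ] GNSSpace I) c
    rw [Algebra.algebraMap_eq_smul_one, leftMul_smul, leftMul_one,
      Algebra.algebraMap_eq_smul_one])
  map_star' a := Subtype.ext (leftMul_star a)

theorem coe_leftHom (a : AlgTensor I) :
    (leftHom I a : GNSSpace I →L[ℂ] GNSSpace I) = leftMul a := rfl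

theorem leftHom_congr {N : ℕ} {a b : AlgTensor I} (h : ∀ n, N ≤ n → a.1 n = b.1 n) :
    leftHom I a = leftHom I b :=
  Subtype.ext <| clm_ext fun c => by
    rw [coe_leftHom, coe_leftHom, leftMul_coe, leftMul_coe]
    refine coe_eq_of_eventually_eq (N := N) fun n hn => ?_
    rw [AlgTensor.mul_apply, AlgTensor.mul_apply, h n hn]

theorem leftHom_congr_level {N : ℕ} {a b : AlgTensor I} (ha : a ∈ levelAlg I N)
    (hb : b ∈ levelAlg I N) (h : a.1 N = b.1 N) : leftHom I a = leftHom I b :=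
  leftHom_congr (eq_of_mem_levelAlg ha hb h)

/-- Since `τ` is a trace, right multiplication is bounded as well. -/
theorem exists_bound_right (a : AlgTensor I) : ∃ C : ℝ, ∀ b : AlgTensor I, ‖b * a‖ ≤ C * ‖b‖ := by
  obtain ⟨C, hC⟩ := exists_bound (star a)
  refine ⟨C, fun b => ?_⟩
  rw [← AlgTensor.norm_star (b * a), star_mul, ← AlgTensor.norm_star b]
  exact hC (star b)

/-- The operator of right multiplication by `a` on the GNS space. -/
def rightMul (a : AlgTensor I) : GNSSpace I →L[ℂ] GNSSpace I :=
  ((LinearMap.mulRight ℂ a).mkContinuousOfExistsBound (exists_bound_right a)).completion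

theorem rightMul_coe (a b : AlgTensor I) :
    rightMul a (b : GNSSpace I) = ((b * a : AlgTensor I) : GNSSpace I) :=
  ContinuousLinearMap.completion_apply_coe _ b

theorem rightMul_vac (a : AlgTensor I) : rightMul a (vac I) = (a : GNSSpace I) := by
  rw [vac, rightMul_coe, one_mul]

theorem rightMul_mul (a b : AlgTensor I) : rightMul (a * b) = rightMul b * rightMul a :=
  clm_ext fun c => by
    rw [mul_apply_eq_comp, rightMul_coe, rightMul_coe, rightMul_coe, mul_assoc]

theorem rightMul_star (a : AlgTensor I) : rightMul (star a) = star (rightMul a) := by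
  rw [ContinuousLinearMap.star_eq_adjoint, ContinuousLinearMap.eq_adjoint_iff]
  intro ξ η
  induction ξ, η using UniformSpace.Completion.induction_on₂ with
  | hp => exact isClosed_eq (by fun_prop) (by fun_prop)
  | ih b c =>
    rw [rightMul_coe, rightMul_coe, UniformSpace.Completion.inner_coe,
      UniformSpace.Completion.inner_coe, inner_eq_tau, inner_eq_tau, star_mul, star_star,
      mul_assoc, tau_mul_comm, mul_assoc]

/-- The operators of `R` commute with right multiplications. -/
theorem apply_rightMul (x : (tensorFactor I).toStarSubalgebra) (a : AlgTensor I)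
    (ξ : GNSSpace I) :
    (x : GNSSpace I →L[ℂ] GNSSpace I) (rightMul a ξ) = rightMul a (x.1 ξ) := by
  have hr : rightMul a ∈ StarSubalgebra.centralizer ℂ (Set.range (leftMul (I := I))) := by
    rw [StarSubalgebra.mem_centralizer_iff]
    have h : ∀ b, leftMul b * rightMul a = rightMul a * leftMul b := fun b =>
      clm_ext fun c => by
        rw [mul_apply_eq_comp, mul_apply_eq_comp, rightMul_coe,
          leftMul_coe, leftMul_coe, rightMul_coe, mul_assoc]
    rintro _ ⟨b, rfl⟩
    refine ⟨h b, ?_⟩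
    rw [← leftMul_star]
    exact h _
  have hx : x.1 ∈ StarSubalgebra.centralizer ℂ
      (StarSubalgebra.centralizer ℂ (Set.range (leftMul (I := I))) :
        Set (GNSSpace I →L[ℂ] GNSSpace I)) := x.2
  rw [StarSubalgebra.mem_centralizer_iff] at hx
  exact (congrArg (fun T : GNSSpace I →L[ℂ] GNSSpace I => T ξ) (hx _ hr).1).symm

theorem apply_coe (x : (tensorFactor I).toStarSubalgebra) (b : AlgTensor I) :
    (x : GNSSpace I →L[ℂ] GNSSpace I) (b : GNSSpace I) = rightMul b (x.1 (vac I)) := by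
  rw [← rightMul_vac, apply_rightMul]

/-- The trace vector is separating for `R`. -/
theorem eq_of_apply_vac {x y : (tensorFactor I).toStarSubalgebra}
    (h : x.1 (vac I) = y.1 (vac I)) : x = y :=
  Subtype.ext <| clm_ext fun b => by rw [apply_coe, apply_coe, h]

/-- Operators of `R` are approximated in the trace norm by elements of the algebraic tensor
product. -/
theorem exists_norm_sub_leftHom_vac_lt (x : (tensorFactor I).toStarSubalgebra) {ε : ℝ}
    (hε : 0 < ε) : ∃ a : AlgTensor I, ‖(x - leftHom I a).1 (vac I)‖ < ε := by
  obtain ⟨a, ha⟩ := UniformSpace.Completion.denseRange_coe.exists_dist_lt (x.1 (vac I)) hε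
  refine ⟨a, ?_⟩
  rw [dist_eq_norm] at ha
  have : (x - leftHom I a).1 = x.1 - leftMul a := rfl
  rwa [this, sub_apply, leftMul_vac]

/-! ### Vectors commuting with a finite level -/

theorem sum_single_mul_mul_single {J : Type*} [Fintype J] [DecidableEq J] (y : Matrix J J ℂ) :
    ∑ k, ∑ l, Matrix.single k l (1 : ℂ) * y * Matrix.single l k 1 = y.trace • 1 := by
  have h : ∀ k l, Matrix.single k l (1 : ℂ) * y * Matrix.single l k 1 =
      y l l • Matrix.single k k (1 : ℂ) := fun k l => by
    rw [Matrix.single_mul_mul_single, one_mul, mul_one, Matrix.smul_single, smul_eq_mul, mul_one]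
  simp only [h, ← Finset.sum_smul, ← Finset.smul_sum]
  congr 1
  rw [← Matrix.diagonal_one, Matrix.sum_single_eq_diagonal]

/-- If `ξ` commutes with `M_I(ℂ)^{⊗ n}` then `⟨y, ξ⟩ = ⟨τ(y) 1, ξ⟩` for `y` in `M_I(ℂ)^{⊗ n}`:
averaging `y` over the matrix units of level `n` gives `τ(y) 1`. -/
theorem inner_coe_eq_of_commute {n : ℕ} {ξ : GNSSpace I}
    (hξ : ∀ a ∈ levelAlg I n, leftMul a ξ = rightMul a ξ) {y : AlgTensor I}
    (hy : y ∈ levelAlg I n) :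
    inner ℂ (y : GNSSpace I) ξ = star (tau y) * inner ℂ (vac I) ξ := by
  let e : (Fin n → I) → (Fin n → I) → AlgTensor I :=
    fun k l => liftLevel n (Matrix.single k l (1 : ℂ))
  have he : ∀ k l, e k l ∈ levelAlg I n := fun k l => liftLevel_mem n _
  have hN : (Fintype.card I : ℂ) ^ n ≠ 0 := pow_ne_zero _ (by simp)
  -- Since `ξ` commutes with `e k l`, the left factor can be moved to the right.
  have hterm : ∀ k l, inner ℂ ((e k l * y * e l k : AlgTensor I) : GNSSpace I) ξ =
      inner ℂ ((y * (e l k * e k l) : AlgTensor I) : GNSSpace I) ξ := by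
    intro k l
    rw [mul_assoc (e k l), ← leftMul_coe, ← ContinuousLinearMap.adjoint_inner_right,
      ← ContinuousLinearMap.star_eq_adjoint, ← leftMul_star, hξ _ (star_mem (he k l)),
      rightMul_star, ContinuousLinearMap.star_eq_adjoint,
      ContinuousLinearMap.adjoint_inner_right, rightMul_coe, mul_assoc]
  have h1 : ((∑ k, ∑ l, e k l * y * e l k : AlgTensor I) : GNSSpace I) =
      (((Fintype.card I : ℂ) ^ n * tau y) • (1 : AlgTensor I) : AlgTensor I) := by
    refine coe_eq_of_eventually_eq (eq_of_mem_levelAlg (N := n) ?_ ?_ ?_)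
    · exact sum_mem fun k _ => sum_mem fun l _ => mul_mem (mul_mem (he k l) hy) (he l k)
    · exact SMulMemClass.smul_mem _ (one_mem _)
    · simp only [AlgTensor.sum_apply, AlgTensor.mul_apply, e, liftLevel_apply_self,
        AlgTensor.smul_apply, AlgTensor.one_apply]
      rw [sum_single_mul_mul_single, ← normTrace_eq_tau hy, normTrace, mul_div_cancel₀ _ hN]
  have h2 : ((∑ k, ∑ l, y * (e l k * e k l) : AlgTensor I) : GNSSpace I) =
      (((Fintype.card I : ℂ) ^ n) • y : AlgTensor I) := by
    refine coe_eq_of_eventually_eq (eq_of_mem_levelAlg (N := n) ?_ ?_ ?_)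
    · exact sum_mem fun k _ => sum_mem fun l _ => mul_mem hy (mul_mem (he l k) (he k l))
    · exact SMulMemClass.smul_mem _ hy
    · simp only [AlgTensor.sum_apply, AlgTensor.mul_apply, e, liftLevel_apply_self,
        AlgTensor.smul_apply, ← Finset.mul_sum]
      have : ∑ k : Fin n → I, ∑ l : Fin n → I,
          Matrix.single l k (1 : ℂ) * Matrix.single k l (1 : ℂ) =
            (Fintype.card I : ℂ) ^ n • (1 : Level I n) := by
        simp only [Matrix.single_mul_single_same, mul_one]
        have h : ∑ l : Fin n → I, Matrix.single l l (1 : ℂ) = 1 := by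
          rw [← Matrix.diagonal_one, Matrix.sum_single_eq_diagonal]
        rw [Finset.sum_congr rfl fun _ _ => h, Finset.sum_const, Finset.card_univ, Fintype.card_fun,
          Fintype.card_fin, ← Nat.cast_smul_eq_nsmul ℂ, Nat.cast_pow]
      rw [this, Matrix.mul_smul, Matrix.mul_one]
  let φ : AlgTensor I →+ ℂ := AddMonoidHom.mk' (fun a => inner ℂ (a : GNSSpace I) ξ) fun a b => by
    rw [UniformSpace.Completion.coe_add, inner_add_left]
  have h3 : φ (∑ k, ∑ l, e k l * y * e l k) = φ (∑ k, ∑ l, y * (e l k * e k l)) := by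
    simp only [map_sum]
    exact Finset.sum_congr rfl fun k _ => Finset.sum_congr rfl fun l _ => hterm k l
  change inner ℂ (_ : GNSSpace I) ξ = inner ℂ (_ : GNSSpace I) ξ at h3
  rw [h1, h2, UniformSpace.Completion.coe_smul, UniformSpace.Completion.coe_smul,
    inner_smul_left, inner_smul_left, map_mul, mul_assoc] at h3
  exact (mul_left_cancel₀ ((map_ne_zero _).2 hN) h3).symm

end Nonempty

end AlgTensor

/-! ### Single tensor factors and finite levels in `R` -/

section Sites

variable {I : Type} [Fintype I] [DecidableEq I]

theorem tensorLast_one_add (n : ℕ) (b b' : Matrix I I ℂ) :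
    tensorLast (1 : Level I n) (b + b') = tensorLast 1 b + tensorLast 1 b' := by
  simp only [tensorLast, Matrix.kronecker_add, Matrix.submatrix_add, Pi.add_apply]

theorem tensorLast_one_smul (n : ℕ) (c : ℂ) (b : Matrix I I ℂ) :
    tensorLast (1 : Level I n) (c • b) = c • tensorLast 1 b := by
  simp only [tensorLast, Matrix.kronecker_smul, Matrix.submatrix_smul, Pi.smul_apply]

theorem tensorLast_one_star (n : ℕ) (b : Matrix I I ℂ) :
    tensorLast (1 : Level I n) (star b) = star (tensorLast 1 b) := by
  simp only [tensorLast, Matrix.star_eq_conjTranspose, Matrix.conjTranspose_submatrix,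
    Matrix.conjTranspose_kronecker, Matrix.conjTranspose_one]

variable [Nonempty I]

theorem siteEmb_eq_leftHom (k : ℕ) (b : Matrix I I ℂ) : siteEmb k b = leftHom I (siteAlg k b) := rfl

variable (I) in
/-- The embedding of the tensor factor number `k` in `R` as a `*`-homomorphism. -/
def siteHom (k : ℕ) : Matrix I I ℂ →⋆ₐ[ℂ] (tensorFactor I).toStarSubalgebra where
  toFun := siteEmb k
  map_one' := by
    rw [siteEmb_eq_leftHom, ← map_one (leftHom I)]
    refine leftHom_congr_level (siteAlg_mem_levelAlg k 1) (one_mem _) ?_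
    rw [siteAlg_apply_succ_self, tensorLast_one, AlgTensor.one_apply]
  map_mul' b b' := by
    simp only [siteEmb_eq_leftHom]
    rw [← map_mul]
    refine leftHom_congr_level (siteAlg_mem_levelAlg k _)
      (mul_mem (siteAlg_mem_levelAlg k _) (siteAlg_mem_levelAlg k _)) ?_
    rw [AlgTensor.mul_apply, siteAlg_apply_succ_self, siteAlg_apply_succ_self,
      siteAlg_apply_succ_self, ← tensorLast_mul, mul_one]
  map_zero' := by
    rw [siteEmb_eq_leftHom, ← map_zero (leftHom I)]
    refine leftHom_congr_level (siteAlg_mem_levelAlg k 0) (zero_mem _) ?_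
    have h := tensorLast_one_smul (I := I) k 0 0
    rw [zero_smul, zero_smul] at h
    rw [siteAlg_apply_succ_self, h]
    rfl
  map_add' b b' := by
    simp only [siteEmb_eq_leftHom]
    rw [← map_add]
    refine leftHom_congr_level (siteAlg_mem_levelAlg k _)
      (add_mem (siteAlg_mem_levelAlg k _) (siteAlg_mem_levelAlg k _)) ?_
    rw [siteAlg_apply_succ_self, tensorLast_one_add, ← siteAlg_apply_succ_self,
      ← siteAlg_apply_succ_self]
    rfl
  commutes' c := by
    rw [siteEmb_eq_leftHom, ← AlgHomClass.commutes (leftHom I) c]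
    refine leftHom_congr_level (siteAlg_mem_levelAlg k _) (algebraMap_mem _ c) ?_
    rw [siteAlg_apply_succ_self, Algebra.algebraMap_eq_smul_one, Algebra.algebraMap_eq_smul_one,
      AlgTensor.smul_apply, AlgTensor.one_apply, tensorLast_one_smul, tensorLast_one]
  map_star' b := by
    simp only [siteEmb_eq_leftHom]
    rw [← map_star]
    refine leftHom_congr_level (siteAlg_mem_levelAlg k _) (star_mem (siteAlg_mem_levelAlg k _)) ?_
    rw [AlgTensor.star_apply, siteAlg_apply_succ_self, siteAlg_apply_succ_self,
      tensorLast_one_star]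

variable (I) in
/-- The subalgebra `K_0 ⊗ ⋯ ⊗ K_{n-1}` of `R`. -/
def levelSub (n : ℕ) : StarSubalgebra ℂ (tensorFactor I).toStarSubalgebra :=
  (levelAlg I n).map (leftHom I)

theorem mem_levelSub {n : ℕ} {y : (tensorFactor I).toStarSubalgebra} :
    y ∈ levelSub I n ↔ ∃ a ∈ levelAlg I n, leftHom I a = y := Iff.rfl

theorem levelSub_mono {n k : ℕ} (h : n ≤ k) {y : (tensorFactor I).toStarSubalgebra}
    (hy : y ∈ levelSub I n) : y ∈ levelSub I k := by
  obtain ⟨a, ha, rfl⟩ := hy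
  exact ⟨a, levelAlg_mono h ha, rfl⟩

theorem siteHom_mem_levelSub (k : ℕ) (b : Matrix I I ℂ) : siteHom I k b ∈ levelSub I (k + 1) :=
  ⟨siteAlg k b, siteAlg_mem_levelAlg k b, rfl⟩

theorem commute_siteHom {n k : ℕ} (h : n ≤ k) {y : (tensorFactor I).toStarSubalgebra}
    (hy : y ∈ levelSub I n) (b : Matrix I I ℂ) : Commute y (siteHom I k b) := by
  obtain ⟨a, ha, rfl⟩ := hy
  have ha' : a ∈ levelAlg I (k + 1) := levelAlg_mono (by omega) ha
  have hb := siteAlg_mem_levelAlg k b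
  change leftHom I a * leftHom I (siteAlg k b) = leftHom I (siteAlg k b) * leftHom I a
  rw [← map_mul, ← map_mul]
  refine leftHom_congr_level (mul_mem ha' hb) (mul_mem hb ha') ?_
  rw [AlgTensor.mul_apply, AlgTensor.mul_apply, siteAlg_apply_succ_self, ha k h, ← tensorLast_mul,
    ← tensorLast_mul, mul_one, one_mul, mul_one, one_mul]

/-- The trace is multiplicative on `(K_0 ⊗ ⋯ ⊗ K_{n-1}) ⊗ K_n`. -/
theorem tau_mul_siteAlg {n : ℕ} {v : AlgTensor I} (hv : v ∈ levelAlg I n) (b : Matrix I I ℂ) :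
    tau (v * siteAlg n b) = tau v * (b.trace / Fintype.card I) := by
  have hm : v * siteAlg n b ∈ levelAlg I (n + 1) :=
    mul_mem (levelAlg_mono n.le_succ hv) (siteAlg_mem_levelAlg n b)
  rw [← normTrace_eq_tau hm, ← normTrace_eq_tau hv, AlgTensor.mul_apply, siteAlg_apply_succ_self,
    hv n le_rfl, ← tensorLast_mul, mul_one, one_mul]
  have h : (tensorLast (v.1 n) b).trace = (v.1 n).trace * b.trace := by
    rw [tensorLast, ← Matrix.trace_kronecker]
    exact Fintype.sum_equiv (splitLast n) _ _ fun _ => rfl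
  rw [normTrace, normTrace, h, pow_succ, mul_div_mul_comm]

/-- `R` is a factor: by `inner_coe_eq_of_commute`, a central `x` satisfies `x 1 = ⟨1, x 1⟩ 1`. -/
theorem isFactor_tensorFactor : IsFactor (tensorFactor I) := by
  intro x hx hxc
  rw [VonNeumannAlgebra.mem_commutant_iff] at hxc
  let x' : (tensorFactor I).toStarSubalgebra := ⟨x, hx⟩
  have hcomm : ∀ a : AlgTensor I, leftMul a (x (vac I)) = rightMul a (x (vac I)) := by
    intro a
    have h1 := congrArg (fun S : GNSSpace I →L[ℂ] GNSSpace I => S (vac I))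
      (hxc (leftMul a) (leftHom I a).2)
    simp only [mul_apply_eq_comp] at h1
    rw [h1, leftMul_vac]
    exact apply_coe x' a
  set c : ℂ := inner ℂ (vac I) (x (vac I)) with hc
  have hvac : x (vac I) = c • vac I := by
    refine ext_inner_left ℂ fun η => ?_
    induction η using UniformSpace.Completion.induction_on with
    | hp => exact isClosed_eq (by fun_prop) (by fun_prop)
    | ih y =>
      obtain ⟨n, hn⟩ := exists_mem_levelAlg y
      rw [inner_coe_eq_of_commute (fun a _ => hcomm a) hn, inner_smul_right, ← hc, vac,
        UniformSpace.Completion.inner_coe, inner_eq_tau, mul_one, tau_star, mul_comm]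
  refine ⟨c, ?_⟩
  have := eq_of_apply_vac (x := x') (y := algebraMap ℂ _ c) (by
    change x (vac I) = (algebraMap ℂ (GNSSpace I →L[ℂ] GNSSpace I) c) (vac I)
    rw [hvac, Algebra.algebraMap_eq_smul_one]
    rfl)
  have h2 := congrArg Subtype.val this
  change x = algebraMap ℂ (GNSSpace I →L[ℂ] GNSSpace I) c at h2
  rw [h2, Algebra.algebraMap_eq_smul_one]

end Sites

/-! ### Unitary representations of the dual in a `*`-algebra -/

section DualRep

variable {G : Type*} [Group G] {D : Dual G}

theorem Dual.mat_one_eq (D : Dual G) (g : G) : (D.rep D.one).mat g = 1 := by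
  rw [D.rep_one]
  exact congrArg Subtype.val (MonoidHom.one_apply g)

/-- A unitary representation of `Ĝ` in the `*`-algebra `A`: unitaries `X_π ∈ A ⊗ B(H_π)` with
`X_1 = 1` and `(X_π)₁₂ (X_ρ)₁₃ T = T X_σ` for `T ∈ (σ, π ⊗ ρ)`. The product of the legs
`(X_π)₁₂ (X_ρ)₁₃` is the Kronecker product over `A`. -/
structure IsDualRep {A : Type*} [Ring A] [StarRing A] [Algebra ℂ A] (X : ∀ π : D.Idx, D.Mat π A) :
    Prop where
  one : X D.one = 1
  mul_conjTranspose : ∀ π, X π * (X π)ᴴ = 1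
  conjTranspose_mul : ∀ π, (X π)ᴴ * X π = 1
  tensor : ∀ (π ρ σ : D.Idx) (T : Matrix (Fin (D.dim π) × Fin (D.dim ρ)) (Fin (D.dim σ)) ℂ),
    T ∈ intertwiners (D.rep σ).mat (fun g => (D.rep π).mat g ⊗ₖ (D.rep ρ).mat g) →
    (X π ⊗ₖ X ρ) * scalarMat (A := A) T = scalarMat (A := A) T * X σ

namespace IsDualRep

variable {A : Type*} [Ring A] [StarRing A] [Algebra ℂ A] {X : ∀ π : D.Idx, D.Mat π A}

theorem map {B : Type*} [Ring B] [StarRing B] [Algebra ℂ B] (hX : IsDualRep X)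
    (φ : A →⋆ₐ[ℂ] B) : IsDualRep fun π => (X π).map φ where
  one := by
    rw [hX.one]
    exact Matrix.map_one _ (map_zero φ) (map_one φ)
  mul_conjTranspose π := by
    have := congrArg (fun M => M.map φ) (hX.mul_conjTranspose π)
    simp only [Matrix.map_mul] at this
    rw [Matrix.map_one _ (map_zero φ) (map_one φ)] at this
    rw [← this, ← Matrix.conjTranspose_map _ fun a => map_star φ a]
  conjTranspose_mul π := by
    have := congrArg (fun M => M.map φ) (hX.conjTranspose_mul π)
    simp only [Matrix.map_mul] at this
    rw [Matrix.map_one _ (map_zero φ) (map_one φ)] at this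
    rw [← this, ← Matrix.conjTranspose_map _ fun a => map_star φ a]
  tensor π ρ σ T hT := by
    have h := congrArg (fun M => M.map φ) (hX.tensor π ρ σ T hT)
    simp only [Matrix.map_mul] at h
    have hs : (scalarMat (A := A) T).map φ = scalarMat (A := B) T := by
      ext a b
      exact AlgHomClass.commutes φ _
    have hk : (X π ⊗ₖ X ρ).map φ = (X π).map φ ⊗ₖ (X ρ).map φ := by
      ext a b
      exact map_mul φ _ _
    rw [hs, hk] at h
    exact h

/-- The product of two representations with commuting entries. -/
theorem mul {Y : ∀ π : D.Idx, D.Mat π A} (hX : IsDualRep X) (hY : IsDualRep Y)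
    (h : ∀ π ρ i j k l, Commute (X π i j) (Y ρ k l)) : IsDualRep fun π => X π * Y π where
  one := by rw [hX.one, hY.one, Matrix.one_mul]
  mul_conjTranspose π := by
    rw [Matrix.conjTranspose_mul, Matrix.mul_assoc, ← Matrix.mul_assoc (Y π),
      hY.mul_conjTranspose, Matrix.one_mul, hX.mul_conjTranspose]
  conjTranspose_mul π := by
    rw [Matrix.conjTranspose_mul, Matrix.mul_assoc, ← Matrix.mul_assoc _ (X π),
      hX.conjTranspose_mul, Matrix.one_mul, hY.conjTranspose_mul]
  tensor π ρ σ T hT := by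
    have hk : (X π * Y π) ⊗ₖ (X ρ * Y ρ) = (X π ⊗ₖ X ρ) * (Y π ⊗ₖ Y ρ) := by
      ext a b
      simp only [Matrix.kroneckerMap_apply, Matrix.mul_apply, Finset.sum_mul_sum,
        Fintype.sum_prod_type]
      refine Finset.sum_congr rfl fun k _ => Finset.sum_congr rfl fun l _ => ?_
      rw [mul_assoc, ← mul_assoc (Y π k b.1), ← (h ρ π a.2 l k b.1).eq, mul_assoc, mul_assoc]
    rw [hk, Matrix.mul_assoc, hY.tensor π ρ σ T hT, ← Matrix.mul_assoc, hX.tensor π ρ σ T hT,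
      Matrix.mul_assoc]

theorem one_rep : IsDualRep (fun _ => 1 : ∀ π : D.Idx, D.Mat π A) where
  one := rfl
  mul_conjTranspose π := by rw [Matrix.conjTranspose_one, Matrix.one_mul]
  conjTranspose_mul π := by rw [Matrix.conjTranspose_one, Matrix.one_mul]
  tensor π ρ σ T hT := by
    have : (1 : D.Mat π A) ⊗ₖ (1 : D.Mat ρ A) = 1 := by
      ext a b
      simp only [Matrix.kroneckerMap_apply, Matrix.one_apply, Prod.ext_iff, ite_and, mul_ite, mul_one,
        mul_zero]
      split_ifs <;> rfl
    rw [this, Matrix.one_mul, Matrix.mul_one]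

theorem kronecker_conjTranspose_mul (hX : IsDualRep X) (π ρ : D.Idx) :
    (X π ⊗ₖ X ρ)ᴴ * (X π ⊗ₖ X ρ) = 1 := by
  ext a b
  have h1 : ∀ k l, ((X π)ᴴ * X π) k l = (1 : D.Mat π A) k l := fun k l => by
    rw [hX.conjTranspose_mul]
  have h2 : ∀ k l, ((X ρ)ᴴ * X ρ) k l = (1 : D.Mat ρ A) k l := fun k l => by
    rw [hX.conjTranspose_mul]
  calc ((X π ⊗ₖ X ρ)ᴴ * (X π ⊗ₖ X ρ)) a b
      = ∑ l, star (X ρ l a.2) * (((X π)ᴴ * X π) a.1 b.1) * X ρ l b.2 := by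
        simp only [Matrix.mul_apply, Matrix.conjTranspose_apply, Matrix.kroneckerMap_apply,
          Fintype.sum_prod_type, star_mul, Finset.mul_sum, Finset.sum_mul]
        rw [Finset.sum_comm]
        simp only [mul_assoc]
    _ = (1 : D.Mat π A) a.1 b.1 * ((X ρ)ᴴ * X ρ) a.2 b.2 := by
        simp only [h1, Matrix.one_apply, mul_ite, ite_mul, mul_one, mul_zero, zero_mul, one_mul]
        split_ifs
        · rfl
        · simp
    _ = _ := by
        rw [h2]
        simp only [Matrix.one_apply, Prod.ext_iff, ite_and, mul_ite, mul_one, mul_zero]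
        split_ifs <;> rfl

/-- The inner action `x ↦ X_π (x ⊗ 1) X_π*`. -/
def ad [StarModule ℂ A] (hX : IsDualRep X) (π : D.Idx) : A →⋆ₐ[ℂ] D.Mat π A where
  toFun x := X π * ampl (n := Fin (D.dim π)) x * (X π)ᴴ
  map_one' := by
    have : (ampl (1 : A) : D.Mat π A) = 1 := Matrix.diagonal_one
    rw [this, Matrix.mul_one, hX.mul_conjTranspose]
  map_mul' x y := by
    have : (ampl (x * y) : D.Mat π A) = ampl x * ((X π)ᴴ * X π) * ampl y := by
      rw [hX.conjTranspose_mul, Matrix.mul_one, Matrix.diagonal_mul_diagonal]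
    rw [this]
    simp only [Matrix.mul_assoc]
  map_zero' := by
    have : (ampl (0 : A) : D.Mat π A) = 0 := Matrix.diagonal_zero
    rw [this, Matrix.mul_zero, Matrix.zero_mul]
  map_add' x y := by
    have : (ampl (x + y) : D.Mat π A) = ampl x + ampl y := (Matrix.diagonal_add _ _).symm
    rw [this, Matrix.mul_add, Matrix.add_mul]
  commutes' c := by
    have : (ampl (algebraMap ℂ A c) : D.Mat π A) = c • (1 : D.Mat π A) := by
      rw [← Algebra.algebraMap_eq_smul_one]
      rfl
    rw [this, Matrix.mul_smul, Matrix.smul_mul, Matrix.mul_one, hX.mul_conjTranspose,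
      Algebra.algebraMap_eq_smul_one]
  map_star' x := by
    have : (ampl (star x) : D.Mat π A) = (ampl x)ᴴ := (Matrix.diagonal_conjTranspose _).symm
    rw [this, Matrix.star_eq_conjTranspose, Matrix.conjTranspose_mul, Matrix.conjTranspose_mul,
      Matrix.conjTranspose_conjTranspose, Matrix.mul_assoc]

theorem ad_apply [StarModule ℂ A] (hX : IsDualRep X) (π : D.Idx) (x : A) (i j : Fin (D.dim π)) :
    hX.ad π x i j = ∑ k, X π i k * x * star (X π j k) := by
  change (X π * ampl (n := Fin (D.dim π)) x * (X π)ᴴ) i j = _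
  rw [Matrix.mul_apply]
  refine Finset.sum_congr rfl fun k _ => ?_
  rw [Matrix.mul_diagonal, Matrix.conjTranspose_apply]

theorem ad_tensor [StarModule ℂ A] (hX : IsDualRep X) (π ρ σ : D.Idx)
    (T : Matrix (Fin (D.dim π) × Fin (D.dim ρ)) (Fin (D.dim σ)) ℂ)
    (hT : T ∈ intertwiners (D.rep σ).mat (fun g => (D.rep π).mat g ⊗ₖ (D.rep ρ).mat g)) (x : A) :
    tensorId (hX.ad π) (hX.ad ρ x) * scalarMat (A := A) T =
      scalarMat (A := A) T * hX.ad σ x := by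
  have hW : tensorId (hX.ad π) (hX.ad ρ x) = (X π ⊗ₖ X ρ) *
      ampl (n := Fin (D.dim π) × Fin (D.dim ρ)) x * (X π ⊗ₖ X ρ)ᴴ := by
    ext a b
    rw [tensorId, ad_apply, Matrix.mul_apply, Fintype.sum_prod_type]
    refine Finset.sum_congr rfl fun k _ => ?_
    rw [ad_apply, Finset.mul_sum, Finset.sum_mul]
    refine Finset.sum_congr rfl fun l _ => ?_
    rw [Matrix.mul_diagonal, Matrix.conjTranspose_apply, Matrix.kroneckerMap_apply,
      Matrix.kroneckerMap_apply, star_mul]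
    simp only [mul_assoc]
  have hWT : (X π ⊗ₖ X ρ)ᴴ * scalarMat (A := A) T = scalarMat (A := A) T * (X σ)ᴴ := by
    rw [← Matrix.mul_one (_ * scalarMat (A := A) T), ← hX.mul_conjTranspose σ, ← Matrix.mul_assoc,
      Matrix.mul_assoc _ (scalarMat (A := A) T), ← hX.tensor π ρ σ T hT, ← Matrix.mul_assoc _ (_ ⊗ₖ _),
      hX.kronecker_conjTranspose_mul, Matrix.one_mul]
  have hxT : ampl (n := Fin (D.dim π) × Fin (D.dim ρ)) x * scalarMat (A := A) T =
      scalarMat (A := A) T * ampl (n := Fin (D.dim σ)) x := by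
    ext a b
    rw [Matrix.diagonal_mul, Matrix.mul_diagonal]
    exact (Algebra.commutes _ _).symm
  rw [hW, Matrix.mul_assoc, hWT, Matrix.mul_assoc, ← Matrix.mul_assoc (ampl (n := Fin (D.dim π) × Fin (D.dim ρ)) x), hxT,
    Matrix.mul_assoc, ← Matrix.mul_assoc, hX.tensor π ρ σ T hT]
  change _ = scalarMat (A := A) T * (X σ * ampl (n := Fin (D.dim σ)) x * (X σ)ᴴ)
  simp only [Matrix.mul_assoc]

end IsDualRep

/-- The matrix of the coefficient functions `g ↦ π(g)_{ij}`. -/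
def Dual.coeffMat (D : Dual G) (π : D.Idx) : D.Mat π (G → ℂ) := fun i j g => (D.rep π).mat g i j

theorem isDualRep_coeffMat : IsDualRep D.coeffMat where
  one := by
    ext i j g
    have := congrFun (congrFun (D.mat_one_eq g) i) j
    refine this.trans ?_
    rw [Matrix.one_apply, Matrix.one_apply]
    split_ifs <;> rfl
  mul_conjTranspose π := by
    ext i j g
    have := congrFun (congrFun ((D.rep π).isUnitaryMatRep.mul_conjTranspose_self g) i) j
    rw [Matrix.mul_apply] at this
    rw [Matrix.mul_apply, Finset.sum_apply]
    refine this.trans ?_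
    rw [Matrix.one_apply, Matrix.one_apply]
    split_ifs <;> rfl
  conjTranspose_mul π := by
    ext i j g
    have := congrFun (congrFun ((D.rep π).isUnitaryMatRep.conjTranspose_mul_self g) i) j
    rw [Matrix.mul_apply] at this
    rw [Matrix.mul_apply, Finset.sum_apply]
    refine this.trans ?_
    rw [Matrix.one_apply, Matrix.one_apply]
    split_ifs <;> rfl
  tensor π ρ σ T hT := by
    ext a b g
    have := congrFun (congrFun (hT g) a) b
    rw [Matrix.mul_apply, Matrix.mul_apply] at this
    rw [Matrix.mul_apply, Matrix.mul_apply, Finset.sum_apply, Finset.sum_apply]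
    exact this.symm

/-! ### The representations `λ̃ⁿ` in `R` -/

variable [Fintype G] [DecidableEq G]

theorem lambdaSite_eq_map (T : BasisChoice D) (k : ℕ) (π : D.Idx) :
    lambdaSite T k π =
      (D.coeffMat π).map ((siteHom D.Coeff k).comp (multHom D)) := by
  ext1 i j
  change siteHom D.Coeff k (lambdaMat T π i j) = siteHom D.Coeff k (multHom D _)
  rw [lambdaMat_eq_multHom]
  rfl

theorem isDualRep_lambdaSite (T : BasisChoice D) (k : ℕ) : IsDualRep (lambdaSite T k) := by
  have : lambdaSite T k = fun π =>
      (D.coeffMat π).map ((siteHom D.Coeff k).comp (multHom D)) :=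
    funext fun π => lambdaSite_eq_map T k π
  rw [this]
  exact isDualRep_coeffMat.map _

theorem lambdaSite_mem_levelSub (T : BasisChoice D) (k : ℕ) (π : D.Idx) (i j : Fin (D.dim π)) :
    lambdaSite T k π i j ∈ levelSub D.Coeff (k + 1) :=
  siteHom_mem_levelSub k _

theorem commute_lambdaSite (T : BasisChoice D) {n k : ℕ} (h : n ≤ k)
    {y : (modelAlgebra D).toStarSubalgebra} (hy : y ∈ levelSub D.Coeff n) (π : D.Idx)
    (i j : Fin (D.dim π)) : Commute y (lambdaSite T k π i j) :=
  commute_siteHom h hy _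

theorem lambdaTilde_mem_levelSub (T : BasisChoice D) (n : ℕ) (π : D.Idx) (i j : Fin (D.dim π)) :
    lambdaTilde T π n i j ∈ levelSub D.Coeff n := by
  induction n generalizing i j with
  | zero =>
    rw [lambdaTilde, Matrix.one_apply]
    split_ifs
    · exact one_mem _
    · exact zero_mem _
  | succ n ih =>
    rw [lambdaTilde, Matrix.mul_apply]
    exact sum_mem fun k _ =>
      mul_mem (levelSub_mono n.le_succ (ih i k)) (lambdaSite_mem_levelSub T n π k j)

theorem isDualRep_lambdaTilde (T : BasisChoice D) (n : ℕ) :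
    IsDualRep fun π => lambdaTilde T π n := by
  induction n with
  | zero => exact IsDualRep.one_rep
  | succ n ih =>
    exact ih.mul (isDualRep_lambdaSite T n) fun π ρ i j k l =>
      commute_lambdaSite T le_rfl (lambdaTilde_mem_levelSub T n π i j) ρ k l

theorem ad_lambdaTilde (T : BasisChoice D) (n : ℕ) (π : D.Idx)
    (x : (modelAlgebra D).toStarSubalgebra) :
    (isDualRep_lambdaTilde T n).ad π x = modelApprox T n π x := rfl

theorem modelApprox_succ (T : BasisChoice D) {n : ℕ} (π : D.Idx)
    {y : (modelAlgebra D).toStarSubalgebra} (hy : y ∈ levelSub D.Coeff n) :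
    modelApprox T (n + 1) π y = modelApprox T n π y := by
  have hc : lambdaSite T n π * ampl (n := Fin (D.dim π)) y =
      ampl (n := Fin (D.dim π)) y * lambdaSite T n π := by
    ext1 i j
    rw [Matrix.mul_diagonal, Matrix.diagonal_mul]
    exact (commute_lambdaSite T le_rfl hy π i j).symm.eq
  simp only [modelApprox, lambdaTilde]
  rw [Matrix.conjTranspose_mul, Matrix.mul_assoc (lambdaTilde T π n), hc, Matrix.mul_assoc,
    Matrix.mul_assoc, ← Matrix.mul_assoc (lambdaSite T n π),
    (isDualRep_lambdaSite T n).mul_conjTranspose, Matrix.one_mul, Matrix.mul_assoc]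

/-- On a finite level the sequence `m_π^n` is eventually constant. -/
theorem modelApprox_eq_of_mem (T : BasisChoice D) {n k : ℕ} (h : n ≤ k) (π : D.Idx)
    {y : (modelAlgebra D).toStarSubalgebra} (hy : y ∈ levelSub D.Coeff n) :
    modelApprox T k π y = modelApprox T n π y := by
  induction k, h using Nat.le_induction with
  | base => rfl
  | succ k hk ih => rw [modelApprox_succ T π (levelSub_mono hk hy), ih]

end DualRep

/-! ### Strong operator limits -/

section StrongLimit

open Filter

variable {H : Type*} [NormedAddCommGroup H] [InnerProductSpace ℂ H] [CompleteSpace H]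

/-- `X_n → x` in the strong operator topology. -/
def StrongLim (X : ℕ → H →L[ℂ] H) (x : H →L[ℂ] H) : Prop :=
  ∀ ξ, Tendsto (fun n => X n ξ) atTop (𝓝 (x ξ))

namespace StrongLim

variable {X Y : ℕ → H →L[ℂ] H} {x y : H →L[ℂ] H}

theorem const (x : H →L[ℂ] H) : StrongLim (fun _ => x) x := fun _ => tendsto_const_nhds

theorem unique (h : StrongLim X x) (h' : StrongLim X y) : x = y := by
  ext ξ
  exact tendsto_nhds_unique (h ξ) (h' ξ)

theorem congr' (h : StrongLim X x) (e : ∀ᶠ n in atTop, X n = Y n) : StrongLim Y x := fun ξ =>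
  (h ξ).congr' (e.mono fun n hn => by rw [hn])

theorem add (h : StrongLim X x) (h' : StrongLim Y y) :
    StrongLim (fun n => X n + Y n) (x + y) := fun ξ => (h ξ).add (h' ξ)

theorem const_mul (z : H →L[ℂ] H) (h : StrongLim X x) : StrongLim (fun n => z * X n) (z * x) :=
  fun ξ => (z.continuous.tendsto _).comp (h ξ)

theorem mul_const (z : H →L[ℂ] H) (h : StrongLim X x) : StrongLim (fun n => X n * z) (x * z) :=
  fun ξ => h (z ξ)

/-- Multiplication is jointly strongly continuous on bounded sets. -/
theorem mul {C : ℝ} (hC : ∀ n, ‖X n‖ ≤ C) (h : StrongLim X x) (h' : StrongLim Y y) :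
    StrongLim (fun n => X n * Y n) (x * y) := fun ξ => by
  have h1 : Tendsto (fun n => X n (Y n ξ - y ξ)) atTop (𝓝 0) := by
    refine squeeze_zero_norm (a := fun n => C * ‖Y n ξ - y ξ‖) (fun n => ?_) ?_
    · exact ((X n).le_opNorm _).trans (mul_le_mul_of_nonneg_right (hC n) (norm_nonneg _))
    · have := (tendsto_iff_norm_sub_tendsto_zero.1 (h' ξ)).const_mul C
      rwa [mul_zero] at this
  have h2 := h1.add (h (y ξ))
  rw [zero_add] at h2
  refine h2.congr fun n => ?_
  rw [map_sub, sub_add_cancel]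
  rfl

theorem sum {ι : Type*} (s : Finset ι) {X : ι → ℕ → H →L[ℂ] H} {x : ι → H →L[ℂ] H}
    (h : ∀ i ∈ s, StrongLim (X i) (x i)) : StrongLim (fun n => ∑ i ∈ s, X i n) (∑ i ∈ s, x i) := by
  classical
  induction s using Finset.induction_on with
  | empty => simpa using const 0
  | insert i s hi ih =>
    simp only [Finset.sum_insert hi]
    exact (h i (Finset.mem_insert_self i s)).add
      (ih fun j hj => h j (Finset.mem_insert_of_mem hj))

/-- If both a sequence and its adjoints converge strongly, the limits are adjoint. -/
theorem star_eq (h : StrongLim X x) (h' : StrongLim (fun n => star (X n)) y) : y = star x := by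
  rw [ContinuousLinearMap.star_eq_adjoint, ContinuousLinearMap.eq_adjoint_iff]
  intro ξ η
  have h1 : Tendsto (fun n => inner ℂ (star (X n) ξ) η) atTop (𝓝 (inner ℂ (y ξ) η)) :=
    (h' ξ).inner tendsto_const_nhds
  have h2 : Tendsto (fun n => inner ℂ ξ (X n η)) atTop (𝓝 (inner ℂ ξ (x η))) :=
    tendsto_const_nhds.inner (h η)
  refine tendsto_nhds_unique (h1.congr fun n => ?_) h2
  rw [ContinuousLinearMap.star_eq_adjoint, ContinuousLinearMap.adjoint_inner_left]

/-- A von Neumann algebra is strongly closed. -/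
theorem mem {M : VonNeumannAlgebra H} (h : StrongLim X x) (hX : ∀ n, X n ∈ M) : x ∈ M := by
  rw [← M.commutant_commutant, VonNeumannAlgebra.mem_commutant_iff]
  intro g hg
  have e : ∀ n, g * X n = X n * g := fun n =>
    (VonNeumannAlgebra.mem_commutant_iff.1 hg (X n) (hX n)).symm
  have h1 := h.const_mul g
  simp only [e] at h1
  exact h1.unique (h.mul_const g)

end StrongLim

/-- A bounded family of operators converges strongly to `0` if it does so on a dense set. -/
theorem tendsto_zero_of_denseRange {ι B : Type*} {l : Filter ι} {X : ι → H →L[ℂ] H} {C : ℝ}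
    (hC : ∀ i, ‖X i‖ ≤ C) {v : B → H} (hv : DenseRange v)
    (h : ∀ b, Tendsto (fun i => X i (v b)) l (𝓝 0)) (ξ : H) :
    Tendsto (fun i => X i ξ) l (𝓝 0) := by
  have hL : ∀ i, LipschitzWith C.toNNReal (X i) := fun i =>
    (X i).lipschitz.weaken (by
      rw [← NNReal.coe_le_coe, coe_nnnorm]
      exact (hC i).trans (Real.le_coe_toNNReal C))
  have hE := (LipschitzWith.uniformEquicontinuous (fun i => ⇑(X i)) _ hL).equicontinuous
  have hcl := hE.isClosed_setOfPred_tendsto (l := l) (f := fun _ => (0 : H)) continuous_const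
  have := hv.induction_on (p := fun ξ => Tendsto (fun i => X i ξ) l (𝓝 0)) ξ hcl h
  exact this

/-- A bounded sequence of operators converges strongly if it is pointwise Cauchy on a dense
set. -/
theorem exists_strongLim_of_denseRange {B : Type*} {X : ℕ → H →L[ℂ] H} {C : ℝ}
    (hC : ∀ n, ‖X n‖ ≤ C) {v : B → H} (hv : DenseRange v)
    (h : ∀ b, ∀ ε > 0, ∃ N, ∀ p ≥ N, ∀ q ≥ N, ‖X p (v b) - X q (v b)‖ < ε) :
    ∃ x, StrongLim X x := by
  have hdiff : ∀ ξ, Tendsto (fun p : ℕ × ℕ => (X p.1 - X p.2) ξ) atTop (𝓝 0) := by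
    refine tendsto_zero_of_denseRange (C := C + C)
      (fun p => (norm_sub_le _ _).trans (add_le_add (hC _) (hC _))) hv fun b => ?_
    rw [Metric.tendsto_nhds]
    intro ε hε
    obtain ⟨N, hN⟩ := h b ε hε
    refine eventually_atTop.2 ⟨(N, N), fun p hp => ?_⟩
    rw [dist_zero_right]
    exact hN _ hp.1 _ hp.2
  have hlim : ∀ ξ, ∃ η, Tendsto (fun n => X n ξ) atTop (𝓝 η) := by
    intro ξ
    refine cauchySeq_tendsto_of_complete ?_
    rw [cauchySeq_iff_tendsto_dist_atTop_0]
    have := (hdiff ξ).norm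
    rw [norm_zero] at this
    refine this.congr fun p => ?_
    rw [dist_eq_norm]
    rfl
  choose f hf using hlim
  exact ⟨continuousLinearMapOfTendsto X (tendsto_pi_nhds.2 hf), hf⟩

end StrongLimit

/-! ### Bounds for inner actions -/

section Bounds

variable {G : Type*} [Group G] {D : Dual G}

theorem norm_apply_le_one_of_conjTranspose_mul {n H : Type*} [Fintype n] [DecidableEq n] [NormedAddCommGroup H]
    [InnerProductSpace ℂ H] [CompleteSpace H] (M : VonNeumannAlgebra H)
    (X : Matrix n n M.toStarSubalgebra) (hX : Xᴴ * X = 1) (i k : n) : ‖(X i k).1‖ ≤ 1 := by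
  refine ContinuousLinearMap.opNorm_le_bound _ zero_le_one fun ξ => ?_
  rw [one_mul, ← sq_le_sq₀ (norm_nonneg _) (norm_nonneg _)]
  have h1 : ∑ j, star (X j k).1 * (X j k).1 = 1 := by
    have := congrArg Subtype.val (congrFun (congrFun hX k) k)
    rw [Matrix.mul_apply, Matrix.one_apply_eq, AddSubmonoidClass.coe_finsetSum] at this
    exact this
  have h2 : ‖ξ‖ ^ 2 = ∑ j, ‖(X j k).1 ξ‖ ^ 2 := by
    rw [@norm_sq_eq_re_inner ℂ]
    have h3 : inner ℂ ξ ((∑ j, star (X j k).1 * (X j k).1) ξ) = inner ℂ ξ ξ := by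
      rw [h1, one_apply_eq_self]
    rw [← h3, sum_apply, inner_sum, map_sum]
    refine Finset.sum_congr rfl fun j _ => ?_
    rw [mul_apply_eq_comp, ContinuousLinearMap.star_eq_adjoint,
      ContinuousLinearMap.adjoint_inner_right, ← norm_sq_eq_re_inner]
  rw [h2]
  exact Finset.single_le_sum (f := fun j => ‖(X j k).1 ξ‖ ^ 2) (fun j _ => by positivity)
    (Finset.mem_univ i)

theorem norm_rightMul_le {I : Type} [Fintype I] [DecidableEq I] [Nonempty I] (a : AlgTensor I) :
    ‖rightMul (star a)‖ ≤ ‖leftMul a‖ := by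
  refine ContinuousLinearMap.opNorm_le_bound _ (norm_nonneg _) fun ξ => ?_
  induction ξ using UniformSpace.Completion.induction_on with
  | hp => exact isClosed_le (by fun_prop) (by fun_prop)
  | ih b =>
    have h := (leftMul a).le_opNorm ((star b : AlgTensor I) : GNSSpace I)
    rw [leftMul_coe, UniformSpace.Completion.norm_coe, UniformSpace.Completion.norm_coe,
      AlgTensor.norm_star] at h
    rw [rightMul_coe, UniformSpace.Completion.norm_coe, UniformSpace.Completion.norm_coe,
      ← AlgTensor.norm_star (b * star a), star_mul, star_star]
    exact h

variable [Fintype G] [DecidableEq G]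

theorem norm_lambdaTilde_le (T : BasisChoice D) (π : D.Idx) (n : ℕ) (i j : Fin (D.dim π)) :
    ‖(lambdaTilde T π n i j).1‖ ≤ 1 :=
  norm_apply_le_one_of_conjTranspose_mul _ _ ((isDualRep_lambdaTilde T n).conjTranspose_mul π) i j

theorem modelApprox_apply (T : BasisChoice D) (n : ℕ) (π : D.Idx)
    (x : (modelAlgebra D).toStarSubalgebra) (i j : Fin (D.dim π)) :
    (modelApprox T n π x i j).1 =
      ∑ k, (lambdaTilde T π n i k).1 * x.1 * star (lambdaTilde T π n j k).1 := by
  rw [← ad_lambdaTilde, IsDualRep.ad_apply, AddSubmonoidClass.coe_finsetSum]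
  rfl

theorem norm_modelApprox_le (T : BasisChoice D) (n : ℕ) (π : D.Idx)
    (x : (modelAlgebra D).toStarSubalgebra) (i j : Fin (D.dim π)) :
    ‖(modelApprox T n π x i j).1‖ ≤ D.dim π * ‖x.1‖ := by
  rw [modelApprox_apply]
  refine (norm_sum_le_of_le Finset.univ (f := fun k => (lambdaTilde T π n i k).1 * x.1 *
    star (lambdaTilde T π n j k).1) (n := fun _ => ‖x.1‖) fun k _ => ?_).trans (by simp)
  have h1 := norm_lambdaTilde_le T π n i k
  have h2 := norm_lambdaTilde_le T π n j k
  calc _ ≤ ‖(lambdaTilde T π n i k).1‖ * ‖x.1‖ * ‖star (lambdaTilde T π n j k).1‖ :=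
        (norm_mul_le _ _).trans (mul_le_mul_of_nonneg_right (norm_mul_le _ _) (norm_nonneg _))
    _ ≤ 1 * ‖x.1‖ * 1 := by
        rw [norm_star]
        gcongr
    _ = ‖x.1‖ := by ring

/-- On the vector `b` the approximations are controlled by the trace norm `‖x 1‖`, uniformly in
`n`: left and right multiplications by the entries of `λ̃ⁿ` are contractions. -/
theorem norm_modelApprox_coe_le (T : BasisChoice D) (n : ℕ) (π : D.Idx)
    (x : (modelAlgebra D).toStarSubalgebra) (i j : Fin (D.dim π)) (b : AlgTensor D.Coeff) :
    ‖(modelApprox T n π x i j).1 (b : ModelSpace D)‖ ≤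
      D.dim π * (‖rightMul b‖ * ‖x.1 (vac D.Coeff)‖) := by
  rw [modelApprox_apply, sum_apply]
  refine (norm_sum_le_of_le Finset.univ
    (n := fun _ => ‖rightMul b‖ * ‖x.1 (vac D.Coeff)‖) fun k _ => ?_).trans (by simp)
  have h1 := norm_lambdaTilde_le T π n i k
  have h2 := norm_lambdaTilde_le T π n j k
  obtain ⟨c, -, hc⟩ := mem_levelSub.1 (lambdaTilde_mem_levelSub T n π j k)
  rw [← hc, coe_leftHom] at h2 ⊢
  rw [mul_apply_eq_comp, mul_apply_eq_comp, ← leftMul_star, leftMul_coe, apply_coe,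
    rightMul_mul, mul_apply_eq_comp]
  have h3 := (norm_rightMul_le c).trans h2
  calc _ ≤ ‖(lambdaTilde T π n i k).1‖ *
        (‖rightMul b‖ * (‖rightMul (star c)‖ * ‖x.1 (vac D.Coeff)‖)) :=
        (ContinuousLinearMap.le_opNorm _ _).trans (mul_le_mul_of_nonneg_left
          ((ContinuousLinearMap.le_opNorm _ _).trans (mul_le_mul_of_nonneg_left
            (ContinuousLinearMap.le_opNorm _ _) (norm_nonneg _))) (norm_nonneg _))
    _ ≤ 1 * (‖rightMul b‖ * (1 * ‖x.1 (vac D.Coeff)‖)) := by gcongr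
    _ = _ := by ring

theorem modelApprox_sub (T : BasisChoice D) (n : ℕ) (π : D.Idx)
    (x y : (modelAlgebra D).toStarSubalgebra) (i j : Fin (D.dim π)) :
    modelApprox T n π (x - y) i j = modelApprox T n π x i j - modelApprox T n π y i j := by
  rw [← ad_lambdaTilde, map_sub]
  rfl

/-! ### Existence of the limit -/

theorem norm_modelApprox_sub_coe_le (T : BasisChoice D) (π : D.Idx)
    (x : (modelAlgebra D).toStarSubalgebra) (i j : Fin (D.dim π)) (b : AlgTensor D.Coeff)
    {N p q : ℕ} (hp : N ≤ p) (hq : N ≤ q) {y : (modelAlgebra D).toStarSubalgebra}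
    (hy : y ∈ levelSub D.Coeff N) :
    ‖(modelApprox T p π x i j).1 (b : ModelSpace D) - (modelApprox T q π x i j).1 b‖ ≤
      D.dim π * (‖rightMul b‖ * ‖(x - y).1 (vac D.Coeff)‖) +
        D.dim π * (‖rightMul b‖ * ‖(x - y).1 (vac D.Coeff)‖) := by
  have e : modelApprox T p π x i j - modelApprox T q π x i j =
      modelApprox T p π (x - y) i j - modelApprox T q π (x - y) i j := by
    rw [modelApprox_sub, modelApprox_sub, modelApprox_eq_of_mem T hp π hy,
      modelApprox_eq_of_mem T hq π hy, sub_sub_sub_cancel_right]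
  have e' : (modelApprox T p π x i j).1 (b : ModelSpace D) - (modelApprox T q π x i j).1 b =
      (modelApprox T p π (x - y) i j).1 b - (modelApprox T q π (x - y) i j).1 b :=
    congrArg (fun z : (modelAlgebra D).toStarSubalgebra => z.1 (b : ModelSpace D)) e
  rw [e']
  exact (norm_sub_le _ _).trans (add_le_add (norm_modelApprox_coe_le T _ π _ i j b)
    (norm_modelApprox_coe_le T _ π _ i j b))

/-- The sequence `m_π^n(x)` converges strongly: it is bounded, and on a dense set of vectors it is
Cauchy, as `x` is a limit in the trace norm of elements of finite levels. -/
theorem exists_strongLim_modelApprox (T : BasisChoice D) (π : D.Idx)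
    (x : (modelAlgebra D).toStarSubalgebra) (i j : Fin (D.dim π)) :
    ∃ y : (modelAlgebra D).toStarSubalgebra,
      StrongLim (fun n => (modelApprox T n π x i j).1) y.1 := by
  obtain ⟨y, hy⟩ := exists_strongLim_of_denseRange
    (fun n => norm_modelApprox_le T n π x i j)
    (UniformSpace.Completion.denseRange_coe (α := AlgTensor D.Coeff)) fun b ε hε => by
      set K : ℝ := 2 * (D.dim π * ‖rightMul b‖) + 1 with hK
      have hK0 : 0 < K := by positivity
      obtain ⟨a, ha⟩ := exists_norm_sub_leftHom_vac_lt x (div_pos hε hK0)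
      obtain ⟨N, hN⟩ := exists_mem_levelAlg a
      refine ⟨N, fun p hp q hq => lt_of_le_of_lt
        (norm_modelApprox_sub_coe_le T π x i j b hp hq (y := leftHom D.Coeff a) ⟨a, hN, rfl⟩) ?_⟩
      set δ := ‖(x - leftHom D.Coeff a).1 (vac D.Coeff)‖ with hδ
      have hδ0 : 0 ≤ δ := norm_nonneg _
      calc _ = (K - 1) * δ := by rw [hK]; ring
        _ ≤ K * δ := mul_le_mul_of_nonneg_right (by linarith) hδ0
        _ < K * (ε / K) := mul_lt_mul_of_pos_left ha hK0
        _ = ε := mul_div_cancel₀ _ hK0.ne'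
  exact ⟨⟨y, hy.mem (M := modelAlgebra D) fun n => (modelApprox T n π x i j).2⟩, hy⟩

open Filter in
/-- `m_π^n(y_n) → m_π(y)` for bounded sequences `y_n → y`. -/
theorem strongLim_modelApprox_of_strongLim (T : BasisChoice D) (π : D.Idx) {C : ℝ}
    {y : ℕ → (modelAlgebra D).toStarSubalgebra} {x z : (modelAlgebra D).toStarSubalgebra}
    (hC : ∀ n, ‖(y n).1‖ ≤ C) (hy : StrongLim (fun n => (y n).1) x.1) (i j : Fin (D.dim π))
    (hz : StrongLim (fun n => (modelApprox T n π x i j).1) z.1) :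
    StrongLim (fun n => (modelApprox T n π (y n) i j).1) z.1 := by
  have h0 : ∀ ξ : ModelSpace D,
      Tendsto (fun n => (modelApprox T n π (y n - x) i j).1 ξ) atTop (𝓝 0) := by
    refine tendsto_zero_of_denseRange (C := D.dim π * (C + ‖x.1‖)) (fun n =>
      (norm_modelApprox_le T n π _ i j).trans ?_) UniformSpace.Completion.denseRange_coe
      fun b => ?_
    · refine mul_le_mul_of_nonneg_left ?_ (Nat.cast_nonneg _)
      exact (norm_sub_le (y n).1 x.1).trans (add_le_add (hC n) le_rfl)
    · refine squeeze_zero_norm (fun n => norm_modelApprox_coe_le T n π _ i j b) ?_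
      have h1 := tendsto_iff_norm_sub_tendsto_zero.1 (hy (vac D.Coeff))
      have h2 := (h1.const_mul ‖rightMul b‖).const_mul (D.dim π : ℝ)
      rw [mul_zero, mul_zero] at h2
      exact h2
  intro ξ
  have h := (h0 ξ).add (hz ξ)
  rw [zero_add] at h
  refine h.congr fun n => ?_
  rw [modelApprox_sub]
  exact sub_add_cancel _ _

end Bounds

section SumLimits

variable {H : Type*} [NormedAddCommGroup H] [InnerProductSpace ℂ H] [CompleteSpace H]
  {M : VonNeumannAlgebra H} {ι : Type*} [Fintype ι]

theorem StrongLim.sum_mul_algebraMap (X : ι → ℕ → M.toStarSubalgebra)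
    (x : ι → M.toStarSubalgebra) (c : ι → ℂ)
    (h : ∀ k, StrongLim (fun n => (X k n).1) (x k).1) :
    StrongLim (fun n => (∑ k, X k n * algebraMap ℂ M.toStarSubalgebra (c k)).1)
      (∑ k, x k * algebraMap ℂ M.toStarSubalgebra (c k)).1 := by
  simp only [AddSubmonoidClass.coe_finsetSum]
  exact StrongLim.sum _ fun k _ =>
    (h k).mul_const (algebraMap ℂ M.toStarSubalgebra (c k)).1

theorem StrongLim.sum_algebraMap_mul (X : ι → ℕ → M.toStarSubalgebra)
    (x : ι → M.toStarSubalgebra) (c : ι → ℂ)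
    (h : ∀ k, StrongLim (fun n => (X k n).1) (x k).1) :
    StrongLim (fun n => (∑ k, algebraMap ℂ M.toStarSubalgebra (c k) * X k n).1)
      (∑ k, algebraMap ℂ M.toStarSubalgebra (c k) * x k).1 := by
  simp only [AddSubmonoidClass.coe_finsetSum]
  exact StrongLim.sum _ fun k _ =>
    (h k).const_mul (algebraMap ℂ M.toStarSubalgebra (c k)).1

theorem apply_eq_sum_of_eq_mul {n : Type*} [Fintype n] {a X b : Matrix n n M.toStarSubalgebra}
    (h : a = X * b) (i j : n) (ξ : H) : (a i j).1 ξ = ∑ k, (X i k).1 ((b k j).1 ξ) := by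
  rw [h, Matrix.mul_apply, AddSubmonoidClass.coe_finsetSum, sum_apply]
  rfl

end SumLimits

/-- If `X (y ⊗ 1) X* a = a (y ⊗ 1)` with `X* X = 1` then the entries of `X* a` commute with `y`. -/
theorem commute_conjTranspose_mul_apply {A n : Type*} [Ring A] [StarRing A] [Fintype n]
    [DecidableEq n] {X a : Matrix n n A} (hX : Xᴴ * X = 1) {y : A}
    (h : X * ampl (n := n) y * Xᴴ * a = a * ampl (n := n) y) (k l : n) :
    y * (Xᴴ * a) k l = (Xᴴ * a) k l * y := by
  have h2 : ampl (n := n) y * (Xᴴ * a) = Xᴴ * a * ampl (n := n) y := by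
    calc ampl (n := n) y * (Xᴴ * a)
        = (Xᴴ * X) * ampl (n := n) y * (Xᴴ * a) := by rw [hX, Matrix.one_mul]
      _ = Xᴴ * (X * ampl (n := n) y * Xᴴ * a) := by simp only [Matrix.mul_assoc]
      _ = Xᴴ * a * ampl (n := n) y := by rw [h, Matrix.mul_assoc]
  have h3 := congrFun (congrFun h2 k) l
  rwa [Matrix.diagonal_mul, Matrix.mul_diagonal] at h3

/-! ### The model action -/

section ModelAction

variable {G : Type*} [Group G] {D : Dual G} [Fintype G] [DecidableEq G] (T : BasisChoice D)

/-- The entries of the limit `m_π(x)`. -/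
def modelLim (π : D.Idx) (x : (modelAlgebra D).toStarSubalgebra) :
    D.Mat π (modelAlgebra D).toStarSubalgebra :=
  fun i j => (exists_strongLim_modelApprox T π x i j).choose

theorem strongLim_modelLim (π : D.Idx) (x : (modelAlgebra D).toStarSubalgebra)
    (i j : Fin (D.dim π)) :
    StrongLim (fun n => (modelApprox T n π x i j).1) (modelLim T π x i j).1 :=
  (exists_strongLim_modelApprox T π x i j).choose_spec

variable {T}

theorem eq_modelLim {π : D.Idx} {x : (modelAlgebra D).toStarSubalgebra}
    {Y : D.Mat π (modelAlgebra D).toStarSubalgebra}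
    (h : ∀ i j, StrongLim (fun n => (modelApprox T n π x i j).1) (Y i j).1) :
    modelLim T π x = Y := by
  ext1 i j
  exact Subtype.ext ((strongLim_modelLim T π x i j).unique (h i j))

variable (T)

theorem modelLim_algebraMap (π : D.Idx) (c : ℂ) :
    modelLim T π (algebraMap ℂ _ c) = algebraMap ℂ _ c := by
  refine eq_modelLim fun i j => ?_
  simp only [← ad_lambdaTilde, AlgHomClass.commutes]
  exact StrongLim.const _

theorem modelLim_add (π : D.Idx) (x y : (modelAlgebra D).toStarSubalgebra) :
    modelLim T π (x + y) = modelLim T π x + modelLim T π y := by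
  refine eq_modelLim fun i j => ?_
  simp only [← ad_lambdaTilde, map_add]
  exact (strongLim_modelLim T π x i j).add (strongLim_modelLim T π y i j)

theorem modelLim_mul (π : D.Idx) (x y : (modelAlgebra D).toStarSubalgebra) :
    modelLim T π (x * y) = modelLim T π x * modelLim T π y := by
  refine eq_modelLim fun i j => ?_
  have e : ∀ n, (modelApprox T n π (x * y) i j).1 =
      ∑ k, (modelApprox T n π x i k).1 * (modelApprox T n π y k j).1 := fun n => by
    rw [← ad_lambdaTilde, map_mul, Matrix.mul_apply, AddSubmonoidClass.coe_finsetSum]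
    rfl
  simp only [e]
  rw [Matrix.mul_apply, AddSubmonoidClass.coe_finsetSum]
  exact StrongLim.sum _ fun k _ => StrongLim.mul (fun n => norm_modelApprox_le T n π x i k)
    (strongLim_modelLim T π x i k) (strongLim_modelLim T π y k j)

theorem modelLim_star (π : D.Idx) (x : (modelAlgebra D).toStarSubalgebra) :
    modelLim T π (star x) = star (modelLim T π x) := by
  ext1 i j
  refine Subtype.ext ?_
  have h1 := strongLim_modelLim T π (star x) i j
  have e : ∀ n, (modelApprox T n π (star x) i j).1 = star (modelApprox T n π x j i).1 :=
    fun n => by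
      rw [← ad_lambdaTilde, map_star]
      rfl
  simp only [e] at h1
  exact (strongLim_modelLim T π x j i).star_eq h1

theorem modelApprox_tensor (n : ℕ) (π ρ σ : D.Idx)
    {S : Matrix (Fin (D.dim π) × Fin (D.dim ρ)) (Fin (D.dim σ)) ℂ}
    (hS : S ∈ intertwiners (D.rep σ).mat (fun g => (D.rep π).mat g ⊗ₖ (D.rep ρ).mat g))
    (x : (modelAlgebra D).toStarSubalgebra) (a : Fin (D.dim π) × Fin (D.dim ρ))
    (b : Fin (D.dim σ)) :
    ∑ c, modelApprox T n π (modelApprox T n ρ x a.2 c.2) a.1 c.1 * algebraMap ℂ _ (S c b) =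
      ∑ t, algebraMap ℂ _ (S a t) * modelApprox T n σ x t b := by
  have h := congrFun (congrFun ((isDualRep_lambdaTilde T n).ad_tensor π ρ σ S hS x) a) b
  rwa [Matrix.mul_apply, Matrix.mul_apply] at h

theorem modelLim_tensor (π ρ σ : D.Idx)
    {S : Matrix (Fin (D.dim π) × Fin (D.dim ρ)) (Fin (D.dim σ)) ℂ}
    (hS : S ∈ intertwiners (D.rep σ).mat (fun g => (D.rep π).mat g ⊗ₖ (D.rep ρ).mat g))
    (x : (modelAlgebra D).toStarSubalgebra) (a : Fin (D.dim π) × Fin (D.dim ρ))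
    (b : Fin (D.dim σ)) :
    ∑ c, modelLim T π (modelLim T ρ x a.2 c.2) a.1 c.1 * algebraMap ℂ _ (S c b) =
      ∑ t, algebraMap ℂ _ (S a t) * modelLim T σ x t b := by
  have hl := StrongLim.sum_mul_algebraMap (M := modelAlgebra D)
    (fun c n => modelApprox T n π (modelApprox T n ρ x a.2 c.2) a.1 c.1)
    (fun c => modelLim T π (modelLim T ρ x a.2 c.2) a.1 c.1) (fun c => S c b) fun c =>
      strongLim_modelApprox_of_strongLim T π (C := D.dim ρ * ‖x.1‖)
        (y := fun n => modelApprox T n ρ x a.2 c.2) (x := modelLim T ρ x a.2 c.2)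
        (z := modelLim T π (modelLim T ρ x a.2 c.2) a.1 c.1)
        (fun n => norm_modelApprox_le T n ρ x a.2 c.2)
        (strongLim_modelLim T ρ x a.2 c.2) a.1 c.1 (strongLim_modelLim T π _ a.1 c.1)
  have hr := StrongLim.sum_algebraMap_mul (M := modelAlgebra D)
    (fun t n => modelApprox T n σ x t b) (fun t => modelLim T σ x t b) (fun t => S a t) fun t =>
      strongLim_modelLim T σ x t b
  simp only [modelApprox_tensor T _ π ρ σ hS x a b] at hl
  exact Subtype.ext (hl.unique hr)

/-- The model action. -/
def modelAction : DualAction D (modelAlgebra D) where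
  map π :=
    { toFun := modelLim T π
      map_one' := by simpa using modelLim_algebraMap T π 1
      map_mul' := modelLim_mul T π
      map_zero' := by simpa using modelLim_algebraMap T π 0
      map_add' := modelLim_add T π
      commutes' := modelLim_algebraMap T π
      map_star' := modelLim_star T π }
  map_one x := by
    refine eq_modelLim fun i j => ?_
    have e : ∀ n, modelApprox T n D.one x = ampl x := fun n => by
      have h1 : lambdaTilde T D.one n = 1 := (isDualRep_lambdaTilde T n).one
      rw [modelApprox, h1, Matrix.conjTranspose_one, Matrix.one_mul, Matrix.mul_one]
    simp only [e]
    exact StrongLim.const _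
  map_tensor π ρ σ S hS x := funext fun a => funext fun b => modelLim_tensor T π ρ σ hS x a b

theorem isModelAction_modelAction : IsModelAction T (modelAction T) :=
  fun π x i j ξ => strongLim_modelLim T π x i j ξ

/-! ### Freeness -/

variable {T}

/-- On a finite level a model action is given by the corresponding `λ̃ⁿ`. -/
theorem IsModelAction.map_eq {m : DualAction D (modelAlgebra D)} (hm : IsModelAction T m)
    (π : D.Idx) {n : ℕ} {y : (modelAlgebra D).toStarSubalgebra} (hy : y ∈ levelSub D.Coeff n) :
    m.map π y = modelApprox T n π y := by
  ext1 i j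
  refine Subtype.ext ?_
  have h1 : StrongLim (fun k => (modelApprox T k π y i j).1) (m.map π y i j).1 := hm π y i j
  refine h1.unique ((StrongLim.const _).congr' ?_)
  filter_upwards [Filter.eventually_ge_atTop n] with k hk
  rw [modelApprox_eq_of_mem T hk π hy]

theorem trace_lambdaMat (T : BasisChoice D) {π : D.Idx} (hπ : π ≠ D.one) (i j : Fin (D.dim π)) :
    (lambdaMat T π i j).trace = 0 := by
  rw [lambdaMat_eq_multHom, trace_multHom, D.sum_mat_eq_zero hπ]

/-- For `π ≠ 1` the entries of `λ̃_π^{n+1}` are orthogonal to level `n`, since their last tensor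
factor has trace zero. -/
theorem exists_lambdaTilde_eq_leftHom (T : BasisChoice D) {π : D.Idx} (hπ : π ≠ D.one) (n : ℕ)
    (i k : Fin (D.dim π)) :
    ∃ u ∈ levelAlg D.Coeff (n + 1), leftHom D.Coeff u = lambdaTilde T π (n + 1) i k ∧
      ∀ c ∈ levelAlg D.Coeff n, tau (star u * c) = 0 := by
  choose v hv hv' using fun l => mem_levelSub.1 (lambdaTilde_mem_levelSub T n π i l)
  refine ⟨∑ l, v l * siteAlg n (lambdaMat T π l k), sum_mem fun l _ =>
    mul_mem (levelAlg_mono n.le_succ (hv l)) (siteAlg_mem_levelAlg _ _), ?_, fun c hc => ?_⟩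
  · rw [lambdaTilde, Matrix.mul_apply, map_sum]
    refine Finset.sum_congr rfl fun l _ => ?_
    rw [map_mul, hv' l]
    rfl
  · have h : tau (star c * ∑ l, v l * siteAlg n (lambdaMat T π l k)) = 0 := by
      rw [Finset.mul_sum]
      refine Finset.sum_induction _ (fun a => tau a = 0) (fun a b ha hb => ?_) ?_ fun l _ => ?_
      · rw [tau_add, ha, hb, add_zero]
      · simpa using tau_smul (I := D.Coeff) 0 0
      · rw [← mul_assoc, tau_mul_siteAlg (mul_mem (star_mem hc) (hv l)), trace_lambdaMat T hπ,
          zero_div, mul_zero]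
    rw [← star_star (_ * c), tau_star, star_mul, star_star, h, star_zero]

/-- For a model action, `m_π(x) a = a (x ⊗ 1)` implies that the entries of `λ̃_π^{n *} a` commute
with level `n`; hence so do the corresponding vectors. -/
theorem IsModelAction.leftMul_eq_rightMul {m : DualAction D (modelAlgebra D)}
    (hm : IsModelAction T m) {π : D.Idx} {a : D.Mat π (modelAlgebra D).toStarSubalgebra}
    (ha : ∀ x, m.map π x * a = a * ampl x) (n : ℕ) (k j : Fin (D.dim π)) {y : AlgTensor D.Coeff}
    (hy : y ∈ levelAlg D.Coeff n) :
    leftMul y ((((lambdaTilde T π n)ᴴ * a) k j).1 (vac D.Coeff)) =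
      rightMul y ((((lambdaTilde T π n)ᴴ * a) k j).1 (vac D.Coeff)) := by
  have hy' : leftHom D.Coeff y ∈ levelSub D.Coeff n := ⟨y, hy, rfl⟩
  have h1 := ha (leftHom D.Coeff y)
  rw [hm.map_eq π hy'] at h1
  have h2 := commute_conjTranspose_mul_apply
    ((isDualRep_lambdaTilde T n).conjTranspose_mul π) h1 k j
  have h3 := congrArg (fun z : (modelAlgebra D).toStarSubalgebra => z.1 (vac D.Coeff)) h2
  refine h3.trans ?_
  rw [← apply_coe, ← leftMul_vac]
  rfl

/-- If `m_π(x) a = a (x ⊗ 1)` for all `x` and `π ≠ 1`, the entries of `a` are orthogonal to every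
finite level. -/
theorem IsModelAction.inner_apply_vac_eq_zero {m : DualAction D (modelAlgebra D)}
    (hm : IsModelAction T m) {π : D.Idx} (hπ : π ≠ D.one)
    {a : D.Mat π (modelAlgebra D).toStarSubalgebra}
    (ha : ∀ x, m.map π x * a = a * ampl x) (c : AlgTensor D.Coeff) (i j : Fin (D.dim π)) :
    inner ℂ (c : ModelSpace D) ((a i j).1 (vac D.Coeff)) = 0 := by
  obtain ⟨n, hc⟩ := exists_mem_levelAlg c
  have hab : a = lambdaTilde T π (n + 1) * ((lambdaTilde T π (n + 1))ᴴ * a) := by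
    have hXX := (isDualRep_lambdaTilde T (n + 1)).mul_conjTranspose π
    rw [← Matrix.mul_assoc, hXX, Matrix.one_mul]
  rw [apply_eq_sum_of_eq_mul hab, inner_sum]
  refine Finset.sum_eq_zero fun k _ => ?_
  obtain ⟨u, hu, hu', hut⟩ := exists_lambdaTilde_eq_leftHom T hπ n i k
  rw [← hu', coe_leftHom, ← ContinuousLinearMap.adjoint_inner_left,
    ← ContinuousLinearMap.star_eq_adjoint, ← leftMul_star, leftMul_coe,
    inner_coe_eq_of_commute (fun y hy => hm.leftMul_eq_rightMul ha (n + 1) k j hy)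
      (mul_mem (star_mem hu) (levelAlg_mono n.le_succ hc)),
    hut c hc, star_zero, zero_mul]

/-- Model actions are free: finite levels are dense and the trace vector is separating, so the
orthogonality of the entries of `a` to all finite levels forces `a = 0`. -/
theorem IsModelAction.isFree {m : DualAction D (modelAlgebra D)} (hm : IsModelAction T m) :
    m.IsFree := by
  rintro π hπ ⟨a, ha0, ha⟩
  refine ha0 ?_
  ext1 i j
  refine eq_of_apply_vac ?_
  change (a i j).1 (vac D.Coeff) = 0
  refine ext_inner_left ℂ fun η => ?_
  rw [inner_zero_right]
  induction η using UniformSpace.Completion.induction_on with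
  | hp => exact isClosed_eq (by fun_prop) (by fun_prop)
  | ih c => exact hm.inner_apply_vac_eq_zero hπ ha c i j

end ModelAction

end GroupDual

end

theorem mainTheorem2 {G : Type*} [Group G] [Finite G] (D : GroupDual.Dual G)
    (T : GroupDual.BasisChoice D) :
    (∃ m : GroupDual.DualAction D (GroupDual.modelAlgebra D), GroupDual.IsModelAction T m) ∧
      ∀ m : GroupDual.DualAction D (GroupDual.modelAlgebra D),
        GroupDual.IsModelAction T m → m.IsOuter := by
  classical
  have := Fintype.ofFinite G
  exact ⟨⟨GroupDual.modelAction T, GroupDual.isModelAction_modelAction T⟩,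
    fun m hm => ⟨GroupDual.isFactor_tensorFactor, hm.isFree⟩⟩
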